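/- **Setting.** Let $\alpha\in C^2(\mathbb R)$ be $1$-periodic with $\alpha>0$, and let $v\in C^3(\mathbb R^2)$ be a real-valued function whose gradient $\nabla v$ is $[0,1]^2$-periodic and does not vanish anywhere in $\mathbb R^2$. Set $$j(x,y,z):=\alpha(z)\,\nabla^\perp v(x,y)=\alpha(z)\,\big(-\partial_y v(x,y),\,\partial_x v(x,y),\,0\big),\qquad (x,y,z)\in\mathbb R^3,$$ which is a $[0,1]^3$-periodic, nowhere vanishing, divergence free field. *Realizability.* The field $j$ is *isotropically realizable in the torus with the conductivity $\sigma$* if $\sigma>0$ is $[0,1]^3$-periodic with $\sigma,\sigma^{-1}\in L^\infty(\mathbb R^3)$, and there is a potential $u\in L^\infty_{\rm loc}(\mathbb R^3)$ with distributional gradient $\nabla u\in L^\infty(\mathbb R^3)^3$ which is $[0,1]^3$-periodic, such that $j=\sigma\nabla u$ almost everywhere. It is *isotropically realizable in the torus* if this holds for some $\sigma$. *The function $w_v$.* The gradient system $\partial_t Z(t,x,y)=\nabla v(Z(t,x,y))$, $Z(0,x,y)=(x,y)$, has a unique solution $Z$ defined for all $t\in\mathbb R$ and $(x,y)\in\mathbb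 R^2$; for each $(x,y)$ there is a unique time $\tau_v(x,y)\in\mathbb R$ such that $v\big(Z(\tau_v(x,y),x,y)\big)=0$. Define $$w_v(x,y):=-\int_0^{\tau_v(x,y)}\Delta v\big(Z(s,x,y)\big)\,ds .$$ *The flow $X_3$.* Let $X_3$ be the unique solution, defined for all $(t,x)\in\mathbb R\times\mathbb R^3$, of $$\partial_t X_3(t,x)=\frac{j\times\operatorname{curl} j}{|j|^2}\big(X_3(t,x)\big),\qquad X_3(0,x)=x .$$ **Proposition.** The objects $Z$, $\tau_v$, $X_3$ above exist and are unique, and: 1. If $w_v\in L^\infty(\mathbb R^2)$, then $j$ is isotropically realizable in the torus. 2. Conversely, if $j$ is isotropically realizable in the torus with a positive $[0,1]^3$-periodic conductivity $\sigma\in C^1(\mathbb R^3)$, then $w_v\in L^\infty(\mathbb R^2)$. 3. If $w_v\in L^\infty(\mathbb R^2)$, then there exists a constant $C\ge 0$ such that $$\int_{-\infty}^{\infty}\frac{|\operatorname{curl} j|^2}{|j|^2}\big(X_3(s,x)\big)\,ds\le C\qquad\text{for all }x\in\mathbb R^3 .$$ -/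

import Mathlib

open MeasureTheory
open scoped Gradient Laplacian InnerProductSpace ContDiff NNReal ENNReal

namespace IsotropicRealizability

noncomputable section

/-- Euclidean space `ℝⁿ`, with its Euclidean norm and Lebesgue measure. -/
abbrev Eucl (n : ℕ) : Type := EuclideanSpace ℝ (Fin n)

/-- The integer vector `k`, as a point of `ℝⁿ`. -/
def latticeVec {n : ℕ} (k : Fin n → ℤ) : Eucl n := WithLp.toLp 2 fun i => (k i : ℝ)

/-- `f` is periodic with respect to the unit cube `[0,1]ⁿ`. -/
def CubePeriodic {n : ℕ} {β : Type*} (f : Eucl n → β) : Prop :=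
  ∀ (k : Fin n → ℤ) (x : Eucl n), f (x + latticeVec k) = f x

/-- Periodicity with respect to the unit cube `[0,1]ⁿ` for classes of functions modulo equality
almost everywhere. -/
def AECubePeriodic {n : ℕ} {β : Type*} (f : Eucl n → β) : Prop :=
  ∀ k : Fin n → ℤ, ∀ᵐ x : Eucl n, f (x + latticeVec k) = f x

/-- The partial derivative `∂ᵢ f` of a real-valued function. -/
def partialDeriv {n : ℕ} (i : Fin n) (f : Eucl n → ℝ) (x : Eucl n) : ℝ :=
  fderiv ℝ f x (EuclideanSpace.single i 1)

/-- The curl of a vector field of `ℝ³`. -/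
def curl (F : Eucl 3 → Eucl 3) (x : Eucl 3) : Eucl 3 :=
  !₂[partialDeriv 1 (fun y => F y 2) x - partialDeriv 2 (fun y => F y 1) x,
     partialDeriv 2 (fun y => F y 0) x - partialDeriv 0 (fun y => F y 2) x,
     partialDeriv 0 (fun y => F y 1) x - partialDeriv 1 (fun y => F y 0) x]

/-- The cross product of `ℝ³`. -/
def cross (a b : Eucl 3) : Eucl 3 := WithLp.toLp 2 (crossProduct a.ofLp b.ofLp)

/-- `X` is the global flow of the autonomous vector field `F`:
`∂ₜ X(t, x) = F (X(t, x))` and `X(0, x) = x`, for all `t ∈ ℝ` and all `x`. -/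
def IsFlow {n : ℕ} (F : Eucl n → Eucl n) (X : ℝ → Eucl n → Eucl n) : Prop :=
  ∀ x : Eucl n, X 0 x = x ∧ ∀ t : ℝ, HasDerivAt (fun s => X s x) (F (X t x)) t

/-- `G` is the gradient of `u` in the sense of distributions:
`∫ u ∂ᵢφ = - ∫ Gᵢ φ` for every test function `φ` and every `i`. -/
def HasWeakGradient {n : ℕ} (u : Eucl n → ℝ) (G : Eucl n → Eucl n) : Prop :=
  LocallyIntegrable u ∧ LocallyIntegrable G ∧
    ∀ φ : Eucl n → ℝ, ContDiff ℝ ∞ φ → HasCompactSupport φ → ∀ i : Fin n,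
      ∫ x, u x * partialDeriv i φ x = - ∫ x, G x i * φ x

/-- `j` is isotropically realizable in the torus with the conductivity `σ`: `σ > 0` is periodic,
`σ` and `σ⁻¹` are in `L^∞`, and there is a potential `u`, locally in `L^∞` and with a periodic weak
gradient `∇u` in `L^∞`, such that `j = σ ∇u` (all of this almost everywhere). -/
def RealizableInTorusWith (j : Eucl 3 → Eucl 3) (σ : Eucl 3 → ℝ) : Prop :=
  (∀ᵐ x : Eucl 3, 0 < σ x) ∧ MemLp σ ∞ ∧ MemLp (fun x => (σ x)⁻¹) ∞ ∧ AECubePeriodic σ ∧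
    ∃ (u : Eucl 3 → ℝ) (gradu : Eucl 3 → Eucl 3),
      (∀ K : Set (Eucl 3), IsCompact K → MemLp u ∞ (volume.restrict K)) ∧
      HasWeakGradient u gradu ∧ MemLp gradu ∞ ∧ AECubePeriodic gradu ∧
      ∀ᵐ x : Eucl 3, j x = σ x • gradu x

/-- A periodic divergence free field `j` is isotropically realizable in the torus. -/
def RealizableInTorus (j : Eucl 3 → Eucl 3) : Prop :=
  ∃ σ : Eucl 3 → ℝ, RealizableInTorusWith j σ

/-- The planar field `j(x,y,z) = α(z) ∇^⊥ v(x,y) = α(z) (-∂_y v(x,y), ∂_x v(x,y), 0)`. -/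
def planarField (α : ℝ → ℝ) (v : Eucl 2 → ℝ) (x : Eucl 3) : Eucl 3 :=
  α (x 2) • !₂[-partialDeriv 1 v !₂[x 0, x 1], partialDeriv 0 v !₂[x 0, x 1], 0]

/-- The vector field `(j × curl j) / |j|²`. -/
def crossCurlField (j : Eucl 3 → Eucl 3) (x : Eucl 3) : Eucl 3 :=
  (‖j x‖ ^ 2)⁻¹ • cross (j x) (curl j x)

/-- `w_v(p) = - ∫₀^{τ(p)} Δv (Z(s, p)) ds`, where `Z` is the flow of `∇v` and `τ(p)` is the time at
which the trajectory issued from `p` meets `{v = 0}`. -/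
def logConductivity (v : Eucl 2 → ℝ) (Z : ℝ → Eucl 2 → Eucl 2) (τ : Eucl 2 → ℝ)
    (p : Eucl 2) : ℝ :=
  - ∫ s in (0 : ℝ)..τ p, Δ v (Z s p)

end

end IsotropicRealizability

open IsotropicRealizability

/-!
The argument takes place in the plane. Let `Z` be the flow of `∇v`, let `τ` be the time at which a
trajectory meets `{v = 0}`, and let `w = w_v`. By the semigroup property `w` has derivative `Δv`
along the trajectories of `∇v` (`hasDerivAt_logConductivity_flow`), that is, `∇w · ∇v = Δv`, or
`div (e^{-w} ∇v) = 0`, or `curl (e^{-w} ∇^⊥ v) = 0`.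

*Boundedness implies realizability.* No differentiability of the flow in its initial point is used:
`w` is locally Lipschitz by Grönwall's inequality (`locallyLipschitz_logConductivity`), hence
differentiable almost everywhere by Rademacher's theorem, so that `e^{-w} ∇^⊥ v` is a locally
Lipschitz field whose curl vanishes almost everywhere. Such a field is the gradient of a function
`U` (`exists_potential_of_ae_curl_eq_zero`): its circulation along rectangles vanishes, by the
fundamental theorem of calculus for absolutely continuous functions. If `w` is bounded, then `U` is
Lipschitz, it is constant along the trajectories of `∇v`, and it increases at a positive rate along
those of `∇^⊥ v`. Since `e^{-w}` need not be periodic, `U` is averaged over the lattice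
(`exists_inherits_const_increments`): limits of Cesàro means of translates of `U` have a periodic
gradient. The three properties of `U` are upper bounds of increments `U q - U p` which hold at all
lattice translates of `p` and `q`, because the flows commute with lattice translations; such bounds
pass to the averages. Thus the averaged function `u` is Lipschitz, and at almost every point its
gradient is a multiple of `∇^⊥ v` by a factor bounded above and below by positive constants
(`gradient_comp_proj`). This factor provides the conductivity.

*Converse.* If `j = σ ∇u` with `σ` of class `C¹`, then the vertical component of `curl (j / σ) = 0`
says that `log (α / σ)` has derivative `-Δv` along the trajectories of `∇v`, so that `w` is a
difference of two values of a bounded function (`exists_logConductivity_le`).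

*The trajectories of `X₃`.* The field `j × curl j / |j|²` equals `((Δv / |∇v|²) ∇v, α' / α)`, and
`|curl j|² / |j|²` equals `(α' / α)² + (Δv)² / |∇v|²`. The projections of the trajectories of `X₃`
to the plane are reparametrized trajectories of `∇v`, and `w(x, y) + log α(z)` is a primitive of
`|curl j|² / |j|²` along the trajectories of `X₃` (`hasDerivAt_logConductivity_add_log`). Its
boundedness bounds the integral.
-/

namespace IsotropicRealizability

open Filter Set Topology

/-! ### Periodic functions -/

section Periodic

variable {n : ℕ}

/-- A point of `ℝⁿ` is brought into the unit cube by a lattice translation. -/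
lemma exists_add_latticeVec_mem_Icc (x : Eucl n) :
    ∃ k : Fin n → ℤ, ∀ i, (x + latticeVec k) i ∈ Icc (0 : ℝ) 1 := by
  refine ⟨fun i => -⌊x i⌋, fun i => ?_⟩
  have h : (x + latticeVec fun i => -⌊x i⌋) i = Int.fract (x i) := by
    simp [latticeVec, Int.fract, sub_eq_add_neg]
  rw [h]
  exact ⟨Int.fract_nonneg _, (Int.fract_lt_one _).le⟩

lemma CubePeriodic.isCompact_range {β : Type*} [TopologicalSpace β] {f : Eucl n → β}
    (hf : CubePeriodic f) (hc : Continuous f) : IsCompact (range f) := by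
  have hK : IsCompact ((EuclideanSpace.equiv (Fin n) ℝ).toHomeomorph ⁻¹'
      (Set.univ.pi fun _ : Fin n => Icc (0 : ℝ) 1)) :=
    (Homeomorph.isCompact_preimage _).2 (isCompact_univ_pi fun _ => isCompact_Icc)
  convert hK.image hc using 1
  refine Subset.antisymm ?_ (image_subset_range _ _)
  rintro _ ⟨x, rfl⟩
  obtain ⟨k, hk⟩ := exists_add_latticeVec_mem_Icc x
  exact ⟨x + latticeVec k, fun i _ => hk i, hf k x⟩

lemma CubePeriodic.exists_norm_le {E : Type*} [SeminormedAddCommGroup E] {f : Eucl n → E}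
    (hf : CubePeriodic f) (hc : Continuous f) : ∃ M : ℝ, 0 < M ∧ ∀ x, ‖f x‖ ≤ M := by
  obtain ⟨M, hM, h⟩ := (hf.isCompact_range hc).isBounded.exists_pos_norm_le
  exact ⟨M, hM, fun x => h _ (mem_range_self x)⟩

lemma CubePeriodic.exists_pos_le {f : Eucl n → ℝ} (hf : CubePeriodic f) (hc : Continuous f)
    (hpos : ∀ x, 0 < f x) : ∃ m : ℝ, 0 < m ∧ ∀ x, m ≤ f x := by
  obtain ⟨_, ⟨x, rfl⟩, hx⟩ := (hf.isCompact_range hc).exists_isLeast (range_nonempty f)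
  exact ⟨f x, hpos x, fun y => hx (mem_range_self y)⟩

lemma CubePeriodic.comp {β γ : Type*} {f : Eucl n → β} (hf : CubePeriodic f) (g : β → γ) :
    CubePeriodic fun x => g (f x) := fun k x => congrArg g (hf k x)

lemma CubePeriodic.comp₂ {β γ δ : Type*} {f : Eucl n → β} {f' : Eucl n → γ}
    (hf : CubePeriodic f) (hf' : CubePeriodic f') (g : β → γ → δ) :
    CubePeriodic fun x => g (f x) (f' x) := fun k x => by simp only [hf k x, hf' k x]

lemma CubePeriodic.fderiv {E : Type*} [NormedAddCommGroup E] [NormedSpace ℝ E]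
    {f : Eucl n → E} (hf : CubePeriodic f) : CubePeriodic (fderiv ℝ f) := fun k x => by
  rw [← fderiv_comp_add_right]
  congr 1
  exact funext (hf k)

lemma CubePeriodic.exists_lipschitzWith {E : Type*} [NormedAddCommGroup E] [NormedSpace ℝ E]
    {f : Eucl n → E} (hf : CubePeriodic f) (hc : ContDiff ℝ 1 f) :
    ∃ K : ℝ≥0, LipschitzWith K f := by
  obtain ⟨M, hM, h⟩ := hf.fderiv.exists_norm_le (hc.continuous_fderiv one_ne_zero)
  refine ⟨⟨M, hM.le⟩, lipschitzWith_of_nnnorm_fderiv_le (hc.differentiable one_ne_zero) fun x => ?_⟩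
  exact_mod_cast h x

end Periodic

/-! ### Global flows of bounded Lipschitz vector fields -/

section Flow

variable {n : ℕ} {F : Eucl n → Eucl n} {X : ℝ → Eucl n → Eucl n} {K : ℝ≥0}

/-- Integral curves of a Lipschitz field are determined by their value at one time. -/
lemma integralCurve_unique (hF : LipschitzWith K F) {γ δ : ℝ → Eucl n} (t₀ : ℝ)
    (hγ : ∀ t, HasDerivAt γ (F (γ t)) t) (hδ : ∀ t, HasDerivAt δ (F (δ t)) t)
    (h : γ t₀ = δ t₀) : γ = δ :=
  ODE_solution_unique_univ (v := fun _ => F) (s := fun _ => univ) (t₀ := t₀)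
    (fun _ => hF.lipschitzOnWith) (fun t => ⟨hγ t, mem_univ _⟩) (fun t => ⟨hδ t, mem_univ _⟩) h

/-- For a bounded Lipschitz field the Picard–Lindelöf theorem applies on every interval
`[-T, T]`, since a curve of bounded speed stays in a ball known beforehand. -/
lemma exists_integralCurve_Icc (hF : LipschitzWith K F) {M : ℝ≥0} (hM : ∀ x, ‖F x‖ ≤ M)
    (x : Eucl n) (T : ℝ≥0) :
    ∃ γ : ℝ → Eucl n, γ 0 = x ∧
      ∀ t ∈ Icc (-(T : ℝ)) T, HasDerivWithinAt γ (F (γ t)) (Icc (-(T : ℝ)) T) t := by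
  have hpl : IsPicardLindelof (fun _ : ℝ => F) (tmin := -(T : ℝ)) (tmax := T)
      ⟨0, by simp⟩ x (M * T) 0 M K := by
    refine ⟨fun _ _ => hF.lipschitzOnWith, fun _ _ => continuousOn_const, fun _ _ y _ => hM y, ?_⟩
    simp
  exact hpl.exists_eq_forall_mem_Icc_hasDerivWithinAt₀

lemma exists_integralCurve (hF : LipschitzWith K F) {M : ℝ≥0} (hM : ∀ x, ‖F x‖ ≤ M)
    (x : Eucl n) : ∃ γ : ℝ → Eucl n, γ 0 = x ∧ ∀ t, HasDerivAt γ (F (γ t)) t := by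
  choose γ h0 hγ using fun N : ℕ => exists_integralCurve_Icc hF hM x (N + 1)
  have hγ' : ∀ (N : ℕ) (t : ℝ), |t| < N + 1 → HasDerivAt (γ N) (F (γ N t)) t := by
    intro N t ht
    rw [abs_lt] at ht
    exact (hγ N t (by push_cast; exact ⟨ht.1.le, ht.2.le⟩)).hasDerivAt
      (Icc_mem_nhds (by push_cast; exact ht.1) (by push_cast; exact ht.2))
  have agree : ∀ (N N' : ℕ) (t : ℝ), |t| < N + 1 → |t| < N' + 1 → γ N t = γ N' t := by
    intro N N' t ht ht'
    have hpos : (0 : ℝ) < min ((N : ℝ) + 1) ((N' : ℝ) + 1) := by positivity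
    refine ODE_solution_unique_of_mem_Ioo (v := fun _ => F) (s := fun _ => univ) (K := K)
      (t₀ := 0) (a := -min ((N : ℝ) + 1) (N' + 1)) (b := min ((N : ℝ) + 1) (N' + 1))
      (fun _ _ => hF.lipschitzOnWith) ⟨by linarith, hpos⟩
      (fun s hs => ⟨hγ' N s ?_, mem_univ _⟩) (fun s hs => ⟨hγ' N' s ?_, mem_univ _⟩)
      ((h0 N).trans (h0 N').symm) (abs_lt.1 (lt_min ht ht'))
    · exact (abs_lt.2 hs).trans_le (min_le_left _ _)
    · exact (abs_lt.2 hs).trans_le (min_le_right _ _)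
  have hlt : ∀ t : ℝ, |t| < (⌈|t|⌉₊ : ℝ) + 1 := fun t =>
    (Nat.le_ceil _).trans_lt (lt_add_one _)
  refine ⟨fun t => γ ⌈|t|⌉₊ t, by simpa using h0 _, fun t => ?_⟩
  refine (hγ' _ t (hlt t)).congr_of_eventuallyEq ?_
  filter_upwards [(continuous_abs.tendsto t).eventually (gt_mem_nhds (hlt t))] with s hs
  exact agree _ _ s (hlt s) hs

lemma exists_unique_isFlow (hF : LipschitzWith K F) {M : ℝ} (hM : ∀ x, ‖F x‖ ≤ M) :
    ∃ X : ℝ → Eucl n → Eucl n, ∀ X', IsFlow F X' ↔ X' = X := by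
  have hM0 : 0 ≤ M := (norm_nonneg _).trans (hM 0)
  choose γ h0 hγ using exists_integralCurve hF (M := ⟨M, hM0⟩) hM
  refine ⟨fun t x => γ x t, fun X' => ⟨fun h => ?_, ?_⟩⟩
  · have key : ∀ x, (fun s => X' s x) = γ x := fun x =>
      integralCurve_unique hF 0 (h x).2 (hγ x) ((h x).1.trans (h0 x).symm)
    funext t x
    exact congrFun (key x) t
  · rintro rfl x
    exact ⟨h0 x, hγ x⟩

lemma IsFlow.continuous_time (hX : IsFlow F X) (x : Eucl n) : Continuous fun t => X t x :=
  continuous_iff_continuousAt.2 fun t => ((hX x).2 t).continuousAt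

lemma IsFlow.add (hF : LipschitzWith K F) (hX : IsFlow F X) (s t : ℝ) (x : Eucl n) :
    X s (X t x) = X (s + t) x := by
  refine congrFun (integralCurve_unique hF (γ := fun s => X s (X t x))
    (δ := fun s => X (s + t) x) 0 (hX _).2 (fun r => ?_) ?_) s
  · exact ((hX x).2 (r + t)).comp_add_const r t
  · simp [(hX _).1]

/-- The flow of a periodic field commutes with lattice translations. -/
lemma IsFlow.add_latticeVec (hF : LipschitzWith K F) (hper : CubePeriodic F) (hX : IsFlow F X)
    (k : Fin n → ℤ) (t : ℝ) (x : Eucl n) : X t (x + latticeVec k) = X t x + latticeVec k := by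
  refine congrFun (integralCurve_unique hF (γ := fun s => X s (x + latticeVec k))
    (δ := fun s => X s x + latticeVec k) 0 (hX _).2 (fun r => ?_) ?_) t
  · rw [hper k]
    exact ((hX x).2 r).add_const _
  · simp [(hX _).1]

/-- Reversing time turns a flow of `F` into a flow of `-F`. -/
lemma IsFlow.neg (hX : IsFlow F X) : IsFlow (fun x => -F x) fun t x => X (-t) x := fun x =>
  ⟨by simp [(hX x).1], fun t => by
    simpa using! HasDerivAt.scomp t ((hX x).2 (-t)) (hasDerivAt_neg t)⟩

lemma IsFlow.dist_le (hF : LipschitzWith K F) (hX : IsFlow F X) (t : ℝ) (x y : Eucl n) :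
    dist (X t x) (X t y) ≤ dist x y * Real.exp (K * |t|) := by
  have key : ∀ {F : Eucl n → Eucl n} {X : ℝ → Eucl n → Eucl n}, LipschitzWith K F →
      IsFlow F X → ∀ t : ℝ, 0 ≤ t → dist (X t x) (X t y) ≤ dist x y * Real.exp (K * t) := by
    intro F X hF hX t ht
    simpa using dist_le_of_trajectories_ODE (v := fun _ => F) (a := 0) (b := t)
      (f := fun s => X s x) (g := fun s => X s y) (δ := dist x y) (fun _ => hF)
      (hX.continuous_time x).continuousOn (fun s _ => ((hX x).2 s).hasDerivWithinAt)
      (hX.continuous_time y).continuousOn (fun s _ => ((hX y).2 s).hasDerivWithinAt)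
      (by simp [(hX _).1]) t ⟨ht, le_rfl⟩
  rcases le_total 0 t with ht | ht
  · rw [abs_of_nonneg ht]
    exact key hF hX t ht
  · rw [abs_of_nonpos ht]
    simpa using key (F := fun x => -F x)
      hF.neg hX.neg (-t) (neg_nonneg.2 ht)

end Flow

/-! ### Gradient, Laplacian and partial derivatives -/

section Calculus

variable {n : ℕ}

lemma gradient_apply (f : Eucl n → ℝ) (x : Eucl n) (i : Fin n) :
    (∇ f x) i = partialDeriv i f x := by
  have h := InnerProductSpace.toDual_symm_apply (𝕜 := ℝ) (x := EuclideanSpace.single i (1 : ℝ))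
    (y := fderiv ℝ f x)
  rw [EuclideanSpace.inner_single_right] at h
  simpa [gradient, partialDeriv] using h

lemma fderiv_eq_inner_gradient (f : Eucl n → ℝ) (x y : Eucl n) :
    fderiv ℝ f x y = ⟪∇ f x, y⟫_ℝ := by
  simp [gradient]

lemma norm_gradient (f : Eucl n → ℝ) (x : Eucl n) : ‖∇ f x‖ = ‖fderiv ℝ f x‖ := by
  simp [gradient]

lemma contDiff_gradient {f : Eucl n → ℝ} {m k : ℕ∞} (hf : ContDiff ℝ k f) (h : m + 1 ≤ k) :
    ContDiff ℝ m (∇ f) :=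
  (InnerProductSpace.toDual ℝ (Eucl n)).symm.contDiff.comp
    (hf.fderiv_right (by exact_mod_cast h))

lemma contDiff_partialDeriv {f : Eucl n → ℝ} {m k : ℕ∞} (hf : ContDiff ℝ k f) (h : m + 1 ≤ k)
    (i : Fin n) : ContDiff ℝ m (partialDeriv i f) :=
  (hf.fderiv_right (m := m) (by exact_mod_cast h)).clm_apply contDiff_const

lemma laplacian_eq_sum_partialDeriv {f : Eucl n → ℝ} (hf : ContDiff ℝ 2 f) (x : Eucl n) :
    (Δ f) x = ∑ i, partialDeriv i (partialDeriv i f) x := by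
  rw [InnerProductSpace.laplacian_eq_iteratedFDeriv_orthonormalBasis f
    (EuclideanSpace.basisFun (Fin n) ℝ)]
  refine Finset.sum_congr rfl fun i _ => ?_
  have hd : DifferentiableAt ℝ (fderiv ℝ f) x :=
    (hf.fderiv_right (m := 1) (by norm_num)).differentiable one_ne_zero x
  have h : partialDeriv i f = fun y => fderiv ℝ f y (EuclideanSpace.single i 1) := rfl
  rw [iteratedFDeriv_two_apply, h, partialDeriv, fderiv_clm_apply hd (differentiableAt_const _)]
  simp

lemma contDiff_laplacian {f : Eucl n → ℝ} (hf : ContDiff ℝ 3 f) : ContDiff ℝ 1 (Δ f) := by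
  rw [funext (laplacian_eq_sum_partialDeriv (hf.of_le (by norm_num)))]
  exact ContDiff.sum fun i _ => contDiff_partialDeriv (k := 2) (m := 1)
    (contDiff_partialDeriv (k := 3) hf (by norm_num) i) (by norm_num) i

lemma cubePeriodic_laplacian {f : Eucl n → ℝ} (hf : ContDiff ℝ 2 f) (hper : CubePeriodic (∇ f)) :
    CubePeriodic (Δ f) := by
  have h : ∀ i, CubePeriodic (partialDeriv i f) := fun i => by
    rw [← funext fun x => gradient_apply f x i]
    exact hper.comp fun y => y i
  intro k x
  simp only [laplacian_eq_sum_partialDeriv hf]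
  refine Finset.sum_congr rfl fun i _ => ?_
  exact ((h i).fderiv.comp fun A => A (EuclideanSpace.single i 1)) k x

end Calculus

/-! ### The planar field, its curl and the field `j × curl j / |j|²` -/

section PlanarField

/-- The projection `(x, y, z) ↦ (x, y)`. -/
noncomputable def proj : Eucl 3 →L[ℝ] Eucl 2 :=
  LinearMap.toContinuousLinearMap
    { toFun := fun x => !₂[x 0, x 1]
      map_add' := fun x y => by ext i; fin_cases i <;> simp
      map_smul' := fun c x => by ext i; fin_cases i <;> simp }

lemma proj_apply (x : Eucl 3) : proj x = !₂[x 0, x 1] := rfl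

@[simp] lemma proj_apply_zero (x : Eucl 3) : proj x 0 = x 0 := rfl

@[simp] lemma proj_apply_one (x : Eucl 3) : proj x 1 = x 1 := rfl

/-- The rotation by a quarter turn, so that `perp (∇ v p) = ∇^⊥ v(p)`. -/
noncomputable def perp : Eucl 2 →L[ℝ] Eucl 2 :=
  LinearMap.toContinuousLinearMap
    { toFun := fun a => !₂[-a 1, a 0]
      map_add' := fun x y => by ext i; fin_cases i <;> simp [add_comm]
      map_smul' := fun c x => by ext i; fin_cases i <;> simp }

@[simp] lemma perp_apply_zero (a : Eucl 2) : perp a 0 = -a 1 := rfl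

@[simp] lemma perp_apply_one (a : Eucl 2) : perp a 1 = a 0 := rfl

/-- The point `(p, z)` of `ℝ³` with `p ∈ ℝ²` and `z ∈ ℝ`. -/
def lift (p : Eucl 2) (z : ℝ) : Eucl 3 := !₂[p 0, p 1, z]

@[simp] lemma lift_apply_zero (p : Eucl 2) (z : ℝ) : lift p z 0 = p 0 := rfl

@[simp] lemma lift_apply_one (p : Eucl 2) (z : ℝ) : lift p z 1 = p 1 := rfl

@[simp] lemma lift_apply_two (p : Eucl 2) (z : ℝ) : lift p z 2 = z := rfl

@[simp] lemma proj_lift (p : Eucl 2) (z : ℝ) : proj (lift p z) = p := by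
  ext i; fin_cases i <;> rfl

lemma lift_proj (x : Eucl 3) : lift (proj x) (x 2) = x := by
  ext i; fin_cases i <;> rfl

lemma norm_sq_two (a : Eucl 2) : ‖a‖ ^ 2 = a 0 ^ 2 + a 1 ^ 2 := by
  rw [EuclideanSpace.real_norm_sq_eq, Fin.sum_univ_two]

lemma norm_sq_three (a : Eucl 3) : ‖a‖ ^ 2 = a 0 ^ 2 + a 1 ^ 2 + a 2 ^ 2 := by
  rw [EuclideanSpace.real_norm_sq_eq, Fin.sum_univ_three]

lemma norm_perp (a : Eucl 2) : ‖perp a‖ = ‖a‖ := by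
  rw [← sq_eq_sq₀ (norm_nonneg _) (norm_nonneg _), norm_sq_two, norm_sq_two]
  simp [add_comm]

lemma inner_perp_self (a : Eucl 2) : ⟪perp a, a⟫_ℝ = 0 := by
  simp [PiLp.inner_apply, Fin.sum_univ_two]
  ring

lemma hasDerivAt_lift {γ : ℝ → Eucl 2} {ζ : ℝ → ℝ} {γ' : Eucl 2} {ζ' t : ℝ}
    (hγ : HasDerivAt γ γ' t) (hζ : HasDerivAt ζ ζ' t) :
    HasDerivAt (fun s => lift (γ s) (ζ s)) (lift γ' ζ') t := by
  rw [hasDerivAt_iff_hasFDerivAt, ← hasFDerivWithinAt_univ, hasFDerivWithinAt_euclidean] at hγ ⊢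
  simp only [hasFDerivWithinAt_univ] at hγ ⊢
  intro i
  fin_cases i
  exacts [hγ 0, hγ 1, hζ]

variable {α : ℝ → ℝ} {v : Eucl 2 → ℝ}

lemma planarField_eq (α : ℝ → ℝ) (v : Eucl 2 → ℝ) (x : Eucl 3) :
    planarField α v x = α (x 2) • lift (perp (∇ v (proj x))) 0 := by
  ext i; fin_cases i <;> simp [planarField, lift, ← gradient_apply, proj_apply]

lemma norm_sq_planarField (α : ℝ → ℝ) (v : Eucl 2 → ℝ) (x : Eucl 3) :
    ‖planarField α v x‖ ^ 2 = α (x 2) ^ 2 * ‖∇ v (proj x)‖ ^ 2 := by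
  rw [planarField_eq, norm_smul, mul_pow, Real.norm_eq_abs, sq_abs, norm_sq_three, norm_sq_two]
  simp [add_comm]

lemma partialDeriv_mul_comp_proj {a : ℝ → ℝ} {g : Eucl 2 → ℝ} (x : Eucl 3)
    (ha : DifferentiableAt ℝ a (x 2)) (hg : DifferentiableAt ℝ g (proj x)) (i : Fin 3) :
    partialDeriv i (fun y => a (y 2) * g (proj y)) x =
      a (x 2) * fderiv ℝ g (proj x) (proj (EuclideanSpace.single i 1)) +
        g (proj x) * (deriv a (x 2) * (EuclideanSpace.single i (1 : ℝ) : Eucl 3) 2) := by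
  have h1 : HasFDerivAt (fun y : Eucl 3 => g (proj y)) ((fderiv ℝ g (proj x)).comp proj) x :=
    HasFDerivAt.comp x hg.hasFDerivAt proj.hasFDerivAt
  have h2 : HasFDerivAt (fun y : Eucl 3 => a (y 2))
      (deriv a (x 2) • (EuclideanSpace.proj (2 : Fin 3) : Eucl 3 →L[ℝ] ℝ)) x :=
    HasDerivAt.comp_hasFDerivAt x ha.hasDerivAt
      (EuclideanSpace.proj (2 : Fin 3) : Eucl 3 →L[ℝ] ℝ).hasFDerivAt
  have h3 := h2.mul h1
  rw [partialDeriv, show (fun y : Eucl 3 => a (y 2) * g (proj y)) =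
    (fun y : Eucl 3 => a (y 2)) * fun y : Eucl 3 => g (proj y) from rfl, h3.fderiv]
  simp

lemma proj_single_zero : proj (EuclideanSpace.single 0 1) = EuclideanSpace.single 0 1 := by
  ext i; fin_cases i <;> simp [proj_apply]

lemma proj_single_one : proj (EuclideanSpace.single 1 1) = EuclideanSpace.single 1 1 := by
  ext i; fin_cases i <;> simp [proj_apply]

lemma proj_single_two : proj (EuclideanSpace.single 2 1) = 0 := by
  ext i; fin_cases i <;> simp [proj_apply]

lemma curl_planarField (hα : ContDiff ℝ 2 α) (hv : ContDiff ℝ 3 v) (x : Eucl 3) :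
    curl (planarField α v) x =
      lift (-deriv α (x 2) • ∇ v (proj x)) (α (x 2) * (Δ v) (proj x)) := by
  have h0 : (fun y => planarField α v y 0) = fun y => -(α (y 2) * partialDeriv 1 v (proj y)) := by
    funext y; simp [planarField_eq, gradient_apply]
  have h1 : (fun y => planarField α v y 1) = fun y => α (y 2) * partialDeriv 0 v (proj y) := by
    funext y; simp [planarField_eq, gradient_apply]
  have h2 : (fun y => planarField α v y 2) = fun _ => 0 := by
    funext y; simp [planarField_eq]
  have hdα := (hα.differentiable two_ne_zero) (x 2)
  have hd : ∀ i, DifferentiableAt ℝ (partialDeriv i v) (proj x) := fun i =>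
    (contDiff_partialDeriv (k := 3) (m := 1) hv (by norm_num) i).differentiable
      one_ne_zero _
  ext i
  have hc : partialDeriv 0 (fun _ : Eucl 3 => (0 : ℝ)) x = 0 ∧
      partialDeriv 1 (fun _ : Eucl 3 => (0 : ℝ)) x = 0 := by simp [partialDeriv]
  have hΔ : (Δ v) (proj x) = fderiv ℝ (partialDeriv 0 v) (proj x) (EuclideanSpace.single 0 1) +
      fderiv ℝ (partialDeriv 1 v) (proj x) (EuclideanSpace.single 1 1) := by
    rw [laplacian_eq_sum_partialDeriv (hv.of_le (by norm_num)), Fin.sum_univ_two]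
    rfl
  have hneg : ∀ (i : Fin 3) (f : Eucl 3 → ℝ),
      partialDeriv i (fun y => -f y) x = -partialDeriv i f x := fun i f => by
    simp [partialDeriv, fderiv_fun_neg]
  fin_cases i <;>
  simp [curl, hneg, h0, h1, h2, hc, partialDeriv_mul_comp_proj x hdα (hd 0),
      partialDeriv_mul_comp_proj x hdα (hd 1), proj_single_zero, proj_single_one,
      proj_single_two, hΔ, gradient_apply, lift, mul_comm, mul_add]

lemma curl_sq_div_planarField_sq (hα : ContDiff ℝ 2 α) (hα_pos : ∀ z, 0 < α z)
    (hv : ContDiff ℝ 3 v) (hv_ne : ∀ p, ∇ v p ≠ 0) (x : Eucl 3) :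
    ‖curl (planarField α v) x‖ ^ 2 / ‖planarField α v x‖ ^ 2 =
      (deriv α (x 2) / α (x 2)) ^ 2 + (Δ v) (proj x) ^ 2 / ‖∇ v (proj x)‖ ^ 2 := by
  have ha := (hα_pos (x 2)).ne'
  have hn : ‖∇ v (proj x)‖ ≠ 0 := norm_ne_zero_iff.2 (hv_ne _)
  rw [norm_sq_planarField, curl_planarField hα hv, norm_sq_three]
  have : (lift (-deriv α (x 2) • ∇ v (proj x)) (α (x 2) * (Δ v) (proj x))) 0 ^ 2 +
      (lift (-deriv α (x 2) • ∇ v (proj x)) (α (x 2) * (Δ v) (proj x))) 1 ^ 2 =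
      deriv α (x 2) ^ 2 * ‖∇ v (proj x)‖ ^ 2 := by
    rw [norm_sq_two]; simp; ring
  rw [this]
  simp only [lift_apply_two]
  field_simp

lemma crossCurlField_planarField (hα : ContDiff ℝ 2 α) (hα_pos : ∀ z, 0 < α z)
    (hv : ContDiff ℝ 3 v) (hv_ne : ∀ p, ∇ v p ≠ 0) (x : Eucl 3) :
    crossCurlField (planarField α v) x =
      lift (((Δ v) (proj x) / ‖∇ v (proj x)‖ ^ 2) • ∇ v (proj x))
        (deriv α (x 2) / α (x 2)) := by
  have ha := (hα_pos (x 2)).ne'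
  have hn : ‖∇ v (proj x)‖ ≠ 0 := norm_ne_zero_iff.2 (hv_ne _)
  rw [crossCurlField, norm_sq_planarField, curl_planarField hα hv, planarField_eq]
  ext i
  fin_cases i
  · simp [cross, cross_apply]
    field_simp
  · simp [cross, cross_apply]
    field_simp
  · simp [cross, cross_apply]
    field_simp
    rw [norm_sq_two]
    ring

end PlanarField

/-! ### The gradient flow, the hitting time of `{v = 0}` and the function `w_v` -/

section GradientFlow

lemma mul_abs_sub_le_abs_sub_of_le_deriv {h h' : ℝ → ℝ} {m : ℝ}
    (hd : ∀ t, HasDerivAt h (h' t) t) (hm : ∀ t, m ≤ h' t) (s t : ℝ) :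
    m * |t - s| ≤ |h t - h s| := by
  have key : ∀ s t, s ≤ t → m * (t - s) ≤ h t - h s := fun s t hst =>
    mul_sub_le_image_sub_of_le_deriv (fun t => (hd t).differentiableAt)
      (fun t => by rw [(hd t).deriv]; exact hm t) hst
  rcases le_total s t with hst | hst
  · rw [abs_of_nonneg (sub_nonneg.2 hst)]
    exact (key s t hst).trans (le_abs_self _)
  · rw [abs_sub_comm, abs_sub_comm (h t), abs_of_nonneg (sub_nonneg.2 hst)]
    exact (key t s hst).trans (le_abs_self _)

variable {v : Eucl 2 → ℝ} {Z : ℝ → Eucl 2 → Eucl 2} {τ : Eucl 2 → ℝ} {K : ℝ≥0} {m M : ℝ}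

lemma IsFlow.hasDerivAt_comp_gradientFlow (hZ : IsFlow (∇ v) Z) (hv : Differentiable ℝ v)
    (p : Eucl 2) (t : ℝ) : HasDerivAt (fun s => v (Z s p)) (‖∇ v (Z t p)‖ ^ 2) t := by
  have h := (hv (Z t p)).hasFDerivAt.comp_hasDerivAt t ((hZ p).2 t)
  rwa [fderiv_eq_inner_gradient, real_inner_self_eq_norm_sq] at h

/-- Along a trajectory the function `v` increases at a speed bounded below, so that the trajectory
meets `{v = 0}` exactly once. -/
lemma IsFlow.exists_hittingTime (hZ : IsFlow (∇ v) Z) (hv : Differentiable ℝ v) (hm0 : 0 < m)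
    (hm : ∀ p, m ≤ ‖∇ v p‖ ^ 2) : ∃ τ : Eucl 2 → ℝ, ∀ p t, v (Z t p) = 0 ↔ t = τ p := by
  have hd := hZ.hasDerivAt_comp_gradientFlow hv
  have key : ∀ p s t, s ≤ t → m * (t - s) ≤ v (Z t p) - v (Z s p) := fun p s t hst =>
    mul_sub_le_image_sub_of_le_deriv (fun t => (hd p t).differentiableAt)
      (fun t => by rw [(hd p t).deriv]; exact hm _) hst
  have hsurj : ∀ p, ∃ t, v (Z t p) = 0 := fun p => by
    have hc : Continuous fun t => v (Z t p) :=
      continuous_iff_continuousAt.2 fun t => (hd p t).continuousAt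
    refine hc.surjective ?_ ?_ 0
    · refine tendsto_atTop_mono' atTop (f₁ := fun t => m * t + v (Z 0 p)) ?_
        (tendsto_atTop_add_const_right _ _ (tendsto_id.const_mul_atTop hm0))
      filter_upwards [eventually_ge_atTop 0] with t ht
      linarith [key p 0 t ht]
    · refine tendsto_atBot_mono' atBot ?_
        (tendsto_atBot_add_const_right _ (v (Z 0 p)) (tendsto_id.const_mul_atBot hm0))
      filter_upwards [eventually_le_atBot 0] with t ht
      simp only [id]
      linarith [key p t 0 ht]
  choose τ hτ using hsurj
  refine ⟨τ, fun p t => ⟨fun h => ?_, fun h => h ▸ hτ p⟩⟩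
  have h' := mul_abs_sub_le_abs_sub_of_le_deriv (hd p) (fun _ => hm _) (τ p) t
  rw [h, hτ p, sub_zero, abs_zero] at h'
  exact sub_eq_zero.1 (abs_nonpos_iff.1 (nonpos_of_mul_nonpos_right h' hm0))

lemma hittingTime_flow (hF : LipschitzWith K (∇ v)) (hZ : IsFlow (∇ v) Z)
    (hτ : ∀ p t, v (Z t p) = 0 ↔ t = τ p) (p : Eucl 2) (t : ℝ) : τ (Z t p) = τ p - t := by
  symm
  rw [← hτ, hZ.add hF, sub_add_cancel, hτ]

lemma logConductivity_flow (hF : LipschitzWith K (∇ v)) (hZ : IsFlow (∇ v) Z)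
    (hτ : ∀ p t, v (Z t p) = 0 ↔ t = τ p) (p : Eucl 2) (t : ℝ) :
    logConductivity v Z τ (Z t p) = ∫ s in τ p..t, (Δ v) (Z s p) := by
  simp only [logConductivity, hittingTime_flow hF hZ hτ, hZ.add hF]
  have h : ∫ s in (0 : ℝ)..τ p - t, (Δ v) (Z (s + t) p) =
      ∫ s in 0 + t..τ p - t + t, (Δ v) (Z s p) :=
    intervalIntegral.integral_comp_add_right (fun s => (Δ v) (Z s p)) t
  rw [h, zero_add, sub_add_cancel, ← intervalIntegral.integral_symm]

/-- The function `w_v` solves the transport equation `∇w_v · ∇v = Δv` along the trajectories. -/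
lemma hasDerivAt_logConductivity_flow (hF : LipschitzWith K (∇ v)) (hZ : IsFlow (∇ v) Z)
    (hΔ : Continuous (Δ v)) (hτ : ∀ p t, v (Z t p) = 0 ↔ t = τ p) (p : Eucl 2) (t : ℝ) :
    HasDerivAt (fun s => logConductivity v Z τ (Z s p)) ((Δ v) (Z t p)) t := by
  simp only [logConductivity_flow hF hZ hτ]
  have hc : Continuous fun s => (Δ v) (Z s p) := hΔ.comp (hZ.continuous_time p)
  exact intervalIntegral.integral_hasDerivAt_right (hc.intervalIntegrable _ _)
    hc.stronglyMeasurable.stronglyMeasurableAtFilter hc.continuousAt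

/-- The function `w_v` is locally Lipschitz: the flow and the hitting time are, by Grönwall's
inequality and the lower bound on the speed of `v` along the trajectories. -/
lemma locallyLipschitz_logConductivity (hv : Differentiable ℝ v) (hF : LipschitzWith K (∇ v))
    (hZ : IsFlow (∇ v) Z) (hτ : ∀ p t, v (Z t p) = 0 ↔ t = τ p) (hm0 : 0 < m)
    (hm : ∀ p, m ≤ ‖∇ v p‖ ^ 2) (hM : ∀ p, ‖∇ v p‖ ≤ M) {B : ℝ} (hB : ∀ p, ‖(Δ v) p‖ ≤ B)
    {K' : ℝ≥0} (hΔ : LipschitzWith K' (Δ v)) :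
    LocallyLipschitz (logConductivity v Z τ) := by
  have hM0 : 0 ≤ M := (norm_nonneg _).trans (hM 0)
  have hB0 : 0 ≤ B := (norm_nonneg _).trans (hB 0)
  have hvL : LipschitzWith (NNReal.mk M hM0) v := lipschitzWith_of_nnnorm_fderiv_le hv fun p => by
    rw [← NNReal.coe_le_coe, coe_nnnorm, ← norm_gradient]; exact hM p
  have hspeed : ∀ p t, m * |τ p - t| ≤ |v (Z t p)| := fun p t => by
    have h := mul_abs_sub_le_abs_sub_of_le_deriv (hZ.hasDerivAt_comp_gradientFlow hv p)
      (fun _ => hm _) t (τ p)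
    rwa [(hτ p _).2 rfl, zero_sub, abs_neg] at h
  intro p₀
  -- an upper bound of the hitting time on the unit ball about `p₀`
  set T : ℝ := (|v p₀| + M) / m with hT
  have hT0 : 0 ≤ T := by positivity
  have hτT : ∀ p ∈ Metric.ball p₀ 1, |τ p| ≤ T := fun p hp => by
    have h1 := hspeed p 0
    rw [sub_zero, (hZ p).1] at h1
    have h2 : |v p - v p₀| ≤ M * dist p p₀ := hvL.dist_le_mul p p₀
    have h3 : M * dist p p₀ ≤ M := mul_le_of_le_one_right hM0 (Metric.mem_ball.1 hp).le
    rw [hT, le_div_iff₀ hm0]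
    have h4 := abs_sub_abs_le_abs_sub (v p) (v p₀)
    linarith
  have hexp : ∀ s, |s| ≤ T → ∀ p q, dist (Z s p) (Z s q) ≤ Real.exp (K * T) * dist p q :=
    fun s hs p q => (hZ.dist_le hF s p q).trans (by rw [mul_comm]; gcongr)
  have hτL : ∀ p ∈ Metric.ball p₀ 1, ∀ q ∈ Metric.ball p₀ 1,
      |τ p - τ q| ≤ M * Real.exp (K * T) / m * dist p q := fun p _ q hq => by
    have h1 := hspeed p (τ q)
    have h2 : |v (Z (τ q) p) - v (Z (τ q) q)| ≤ M * dist (Z (τ q) p) (Z (τ q) q) :=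
      hvL.dist_le_mul _ _
    rw [(hτ q _).2 rfl, sub_zero] at h2
    have h3 := mul_le_mul_of_nonneg_left (hexp (τ q) (hτT q hq) p q) hM0
    rw [div_mul_eq_mul_div, le_div_iff₀ hm0]
    linarith
  refine ⟨NNReal.mk (K' * Real.exp (K * T) * T + B * (M * Real.exp (K * T) / m)) (by positivity),
    Metric.ball p₀ 1, Metric.ball_mem_nhds _ one_pos, LipschitzOnWith.of_dist_le_mul ?_⟩
  intro p hp q hq
  have hi : ∀ r a b, IntervalIntegrable (fun s => (Δ v) (Z s r)) volume a b := fun r a b =>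
    (hΔ.continuous.comp (hZ.continuous_time r)).intervalIntegrable a b
  have hsplit : logConductivity v Z τ p - logConductivity v Z τ q =
      (∫ s in (0 : ℝ)..τ q, ((Δ v) (Z s q) - (Δ v) (Z s p))) -
        ∫ s in τ q..τ p, (Δ v) (Z s p) := by
    rw [intervalIntegral.integral_sub (hi q _ _) (hi p _ _), logConductivity, logConductivity,
      ← intervalIntegral.integral_add_adjacent_intervals (hi p 0 (τ q)) (hi p (τ q) (τ p))]
    ring
  have h1 : ‖∫ s in (0 : ℝ)..τ q, ((Δ v) (Z s q) - (Δ v) (Z s p))‖ ≤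
      K' * Real.exp (K * T) * dist p q * |τ q - 0| := by
    refine intervalIntegral.norm_integral_le_of_norm_le_const fun s hs => ?_
    have hs' : |s| ≤ T := by
      have := abs_sub_left_of_mem_uIcc (uIoc_subset_uIcc hs)
      simp only [sub_zero] at this
      exact this.trans (hτT q hq)
    rw [← dist_eq_norm, mul_assoc, dist_comm p q]
    exact (hΔ.dist_le_mul _ _).trans (by gcongr; exact hexp s hs' q p)
  have h2 : ‖∫ s in τ q..τ p, (Δ v) (Z s p)‖ ≤ B * |τ p - τ q| :=
    intervalIntegral.norm_integral_le_of_norm_le_const fun s _ => hB _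
  rw [dist_eq_norm, hsplit]
  refine (norm_sub_le _ _).trans ((add_le_add h1 h2).trans ?_)
  rw [sub_zero]
  have h3 := mul_le_mul_of_nonneg_left (hτT q hq)
    (show 0 ≤ K' * Real.exp (K * T) * dist p q by positivity)
  have h4 := mul_le_mul_of_nonneg_left (hτL p hp q hq) hB0
  calc _ ≤ K' * Real.exp (K * T) * dist p q * T + B * (M * Real.exp (K * T) / m * dist p q) :=
        add_le_add h3 h4
    _ = _ := by rw [NNReal.coe_mk]; ring

end GradientFlow

/-! ### The Poincaré lemma for locally Lipschitz fields of the plane -/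

section Poincare

lemma LocallyLipschitz.exists_lipschitzOnWith {X Y : Type*} [PseudoMetricSpace X]
    [PseudoMetricSpace Y] {f : X → Y} (hf : LocallyLipschitz f) {s : Set X} (hs : IsCompact s) :
    ∃ K, LipschitzOnWith K f s :=
  LocallyLipschitzOn.exists_lipschitzOnWith_of_compact hs (LocallyLipschitz.locallyLipschitzOn hf)

/-- Rademacher's theorem for locally Lipschitz functions. -/
lemma LocallyLipschitz.ae_differentiableAt {E F : Type*} [NormedAddCommGroup E] [NormedSpace ℝ E]
    [FiniteDimensional ℝ E] [MeasurableSpace E] [BorelSpace E] [NormedAddCommGroup F]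
    [NormedSpace ℝ F] [FiniteDimensional ℝ F] {μ : Measure E} [μ.IsAddHaarMeasure] {f : E → F}
    (hf : LocallyLipschitz f) : ∀ᵐ x ∂μ, DifferentiableAt ℝ f x := by
  have h : ∀ N : ℕ, ∀ᵐ x ∂μ, x ∈ Metric.ball (0 : E) N → DifferentiableAt ℝ f x := fun N => by
    obtain ⟨K, hK⟩ := LocallyLipschitz.exists_lipschitzOnWith hf
      (isCompact_closedBall (0 : E) (N : ℝ))
    filter_upwards [(hK.mono Metric.ball_subset_closedBall).ae_differentiableWithinAt_of_mem
      (μ := μ)] with x hx hmem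
    exact (hx hmem).differentiableAt (Metric.isOpen_ball.mem_nhds hmem)
  filter_upwards [ae_all_iff.2 h] with x hx
  obtain ⟨N, hN⟩ := exists_nat_gt ‖x‖
  exact hx N (by simpa using hN)

variable {P Q : ℝ × ℝ → ℝ}

/-- The circulation of a locally Lipschitz field along the boundary of a rectangle vanishes if the
curl of the field does almost everywhere. For fixed `x` both sides are absolutely continuous
functions of `y`, and their derivatives agree almost everywhere. -/
lemma circulation_eq_zero (hP : LocallyLipschitz P) (hQ : LocallyLipschitz Q)
    (hPQ : ∀ᵐ p : ℝ × ℝ, ∃ P' Q' : ℝ × ℝ →L[ℝ] ℝ, HasFDerivAt P P' p ∧ HasFDerivAt Q Q' p ∧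
      P' (0, 1) = Q' (1, 0)) (x y : ℝ) :
    ∫ s in (0 : ℝ)..x, (P (s, y) - P (s, 0)) = ∫ s in (0 : ℝ)..y, (Q (x, s) - Q (0, s)) := by
  have hPs : ∀ y, Continuous fun s => P (s, y) := fun y => hP.continuous.comp (by fun_prop)
  have hQs : ∀ x, Continuous fun s => Q (x, s) := fun x => hQ.continuous.comp (by fun_prop)
  obtain ⟨L, hL⟩ := LocallyLipschitz.exists_lipschitzOnWith hP
    ((isCompact_uIcc (a := (0 : ℝ)) (b := x)).prod (isCompact_Icc (a := -(|y| + 1)) (b := |y| + 1)))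
  have hPL : ∀ s ∈ uIcc 0 x, LipschitzOnWith L (fun t => P (s, t)) (Icc (-(|y| + 1)) (|y| + 1)) :=
    fun s hs t ht t' ht' => by
      simpa [Prod.edist_eq] using hL (show (s, t) ∈ _ from ⟨hs, ht⟩) (show (s, t') ∈ _ from ⟨hs, ht'⟩)
  have hy : uIcc 0 y ⊆ Ioo (-(|y| + 1)) (|y| + 1) := fun t ht => by
    have := abs_sub_left_of_mem_uIcc ht
    simp only [sub_zero] at this
    exact abs_lt.1 (this.trans_lt (lt_add_one _))
  set g : ℝ → ℝ := fun t => (∫ s in (0 : ℝ)..x, P (s, t)) - ∫ s in (0 : ℝ)..t, (Q (x, s) - Q (0, s))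
    with hg
  have hcQ : Continuous fun s => Q (x, s) - Q (0, s) := (hQs x).sub (hQs 0)
  have hg_ac : AbsolutelyContinuousOnInterval g 0 y := by
    refine AbsolutelyContinuousOnInterval.sub ?_ ?_
    · refine LipschitzOnWith.absolutelyContinuousOnInterval (K := L * Real.nnabs x)
        (LipschitzOnWith.of_dist_le_mul fun t ht t' ht' => ?_)
      rw [dist_eq_norm, ← intervalIntegral.integral_sub ((hPs t).intervalIntegrable _ _)
        ((hPs t').intervalIntegrable _ _)]
      refine (intervalIntegral.norm_integral_le_of_norm_le_const (C := L * dist t t')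
        fun s hs => ?_).trans (le_of_eq ?_)
      · rw [← dist_eq_norm]
        exact (hPL s (uIoc_subset_uIcc hs)).dist_le_mul t (Ioo_subset_Icc_self (hy ht)) t'
          (Ioo_subset_Icc_self (hy ht'))
      · simp; ring
    · exact (hcQ.intervalIntegrable 0 y).absolutelyContinuousOnInterval_intervalIntegral (by simp)
  have hg_deriv : ∀ᵐ t, t ∈ uIcc 0 y → HasDerivAt g 0 t := by
    have hswap : ∀ᵐ t : ℝ, ∀ᵐ s : ℝ, ∃ P' Q' : ℝ × ℝ →L[ℝ] ℝ, HasFDerivAt P P' (s, t) ∧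
        HasFDerivAt Q Q' (s, t) ∧ P' (0, 1) = Q' (1, 0) :=
      Measure.ae_ae_of_ae_prod
        ((Measure.measurePreserving_swap (μ := (volume : Measure ℝ))
          (ν := (volume : Measure ℝ))).quasiMeasurePreserving.ae hPQ)
    filter_upwards [hswap] with t ht hty
    obtain ⟨L', hL'⟩ := LocallyLipschitz.exists_lipschitzOnWith hQ
      ((isCompact_uIcc (a := (0 : ℝ)) (b := x)).prod (isCompact_singleton (x := t)))
    have hQac : AbsolutelyContinuousOnInterval (fun s => Q (s, t)) 0 x :=
      LipschitzOnWith.absolutelyContinuousOnInterval (K := L') fun s hs s' hs' => by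
        simpa [Prod.edist_eq] using
          hL' (show (s, t) ∈ _ from ⟨hs, rfl⟩) (show (s', t) ∈ _ from ⟨hs', rfl⟩)
    have h1 : HasDerivAt (fun t => ∫ s in (0 : ℝ)..x, P (s, t))
        (∫ s in (0 : ℝ)..x, deriv (fun s => Q (s, t)) s) t := by
      refine (intervalIntegral.hasDerivAt_integral_of_dominated_loc_of_lip
        (F := fun t s => P (s, t)) (F' := fun s => deriv (fun s => Q (s, t)) s)
        (bound := fun _ => L) (Icc_mem_nhds (hy hty).1 (hy hty).2)
        (Eventually.of_forall fun r => (hPs r).aestronglyMeasurable)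
        ((hPs t).intervalIntegrable _ _) (stronglyMeasurable_deriv _).aestronglyMeasurable
        (Eventually.of_forall fun s hs => ?_) intervalIntegrable_const ?_).2
      · simpa using hPL s (uIoc_subset_uIcc hs)
      · filter_upwards [ht] with s hs _
        obtain ⟨P', Q', hP', hQ', h⟩ := hs
        have h2 : HasDerivAt (fun s => Q (s, t)) (Q' (1, 0)) s :=
          hQ'.comp_hasDerivAt s ((hasDerivAt_id s).prodMk (hasDerivAt_const s t))
        rw [h2.deriv, ← h]
        exact hP'.comp_hasDerivAt t ((hasDerivAt_const t s).prodMk (hasDerivAt_id t))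
    have h2 : HasDerivAt (fun t => ∫ s in (0 : ℝ)..t, (Q (x, s) - Q (0, s)))
        (Q (x, t) - Q (0, t)) t :=
      intervalIntegral.integral_hasDerivAt_right (hcQ.intervalIntegrable _ _)
        hcQ.stronglyMeasurable.stronglyMeasurableAtFilter hcQ.continuousAt
    have h3 := h1.sub h2
    rwa [hQac.integral_deriv_eq_sub, sub_self] at h3
  obtain ⟨C, hC⟩ := hg_ac.const_of_ae_hasDerivAt_zero hg_deriv
  have h := (hC y right_mem_uIcc).trans (hC 0 left_mem_uIcc).symm
  simp only [hg, intervalIntegral.integral_same, sub_zero] at h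
  rw [intervalIntegral.integral_sub ((hPs y).intervalIntegrable _ _)
    ((hPs 0).intervalIntegrable _ _)]
  linarith

/-- A locally Lipschitz field of the plane whose curl vanishes almost everywhere is a gradient. -/
theorem exists_potential_of_ae_curl_eq_zero (hP : LocallyLipschitz P) (hQ : LocallyLipschitz Q)
    (hPQ : ∀ᵐ p : ℝ × ℝ, ∃ P' Q' : ℝ × ℝ →L[ℝ] ℝ, HasFDerivAt P P' p ∧ HasFDerivAt Q Q' p ∧
      P' (0, 1) = Q' (1, 0)) :
    ∃ U : ℝ × ℝ → ℝ, ∀ p, HasFDerivAt U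
      (P p • ContinuousLinearMap.fst ℝ ℝ ℝ + Q p • ContinuousLinearMap.snd ℝ ℝ ℝ) p := by
  have hPs : ∀ y, Continuous fun s => P (s, y) := fun y => hP.continuous.comp (by fun_prop)
  have hQs : ∀ x, Continuous fun s => Q (x, s) := fun x => hQ.continuous.comp (by fun_prop)
  -- the potential is the integral along a path with one horizontal and one vertical segment;
  -- by the vanishing of the circulation, the order of the segments does not matter
  let U : ℝ → ℝ → ℝ := fun x y => (∫ s in (0 : ℝ)..x, P (s, 0)) + ∫ s in (0 : ℝ)..y, Q (x, s)
  have hU : ∀ x y, U x y = (∫ s in (0 : ℝ)..x, P (s, y)) + ∫ s in (0 : ℝ)..y, Q (0, s) := by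
    intro x y
    have h := circulation_eq_zero hP hQ hPQ x y
    rw [intervalIntegral.integral_sub ((hPs y).intervalIntegrable _ _)
      ((hPs 0).intervalIntegrable _ _), intervalIntegral.integral_sub
      ((hQs x).intervalIntegrable _ _) ((hQs 0).intervalIntegrable _ _)] at h
    simp only [U]
    linarith
  refine ⟨fun p => U p.1 p.2, fun p => ?_⟩
  have h1 : ∀ q : ℝ × ℝ, HasFDerivAt (fun x => U x q.2)
      ((P (q.1, q.2)) • ContinuousLinearMap.id ℝ ℝ) q.1 := fun q => by
    simp only [hU]
    have h := (intervalIntegral.integral_hasDerivAt_right ((hPs q.2).intervalIntegrable 0 q.1)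
      (hPs q.2).stronglyMeasurable.stronglyMeasurableAtFilter
      (hPs q.2).continuousAt).add_const (∫ s in (0 : ℝ)..q.2, Q (0, s))
    refine h.hasFDerivAt.congr_fderiv ?_
    ext; simp
  have h2 : ∀ q : ℝ × ℝ, HasFDerivAt (fun y => U q.1 y)
      ((Q (q.1, q.2)) • ContinuousLinearMap.id ℝ ℝ) q.2 := fun q => by
    have h := (intervalIntegral.integral_hasDerivAt_right ((hQs q.1).intervalIntegrable 0 q.2)
      (hQs q.1).stronglyMeasurable.stronglyMeasurableAtFilter
      (hQs q.1).continuousAt).const_add (∫ s in (0 : ℝ)..q.1, P (s, 0))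
    refine h.hasFDerivAt.congr_fderiv ?_
    ext; simp
  have h := (hasStrictFDerivAt_uncurry_coprod (𝕜 := ℝ) (u := p) (f := U)
    (f₁ := fun x y => P (x, y) • ContinuousLinearMap.id ℝ ℝ)
    (f₂ := fun x y => Q (x, y) • ContinuousLinearMap.id ℝ ℝ)
    (Eventually.of_forall h1) (Eventually.of_forall h2)
    (hP.continuous.smul continuous_const).continuousAt
    (hQ.continuous.smul continuous_const).continuousAt).hasFDerivAt
  convert! h using 1

end Poincare

/-! ### Averaging a potential over the lattice -/

section Average

variable {n : ℕ}

lemma latticeVec_add (k l : Fin n → ℤ) : latticeVec (k + l) = latticeVec k + latticeVec l := by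
  ext i; simp [latticeVec]

lemma latticeVec_zero : latticeVec (0 : Fin n → ℤ) = 0 := by
  ext i; simp [latticeVec]

lemma latticeVec_neg (k : Fin n → ℤ) : latticeVec (-k) = -latticeVec k := by
  ext i; simp [latticeVec]

lemma latticeVec_nsmul (i : ℕ) (k : Fin n → ℤ) : latticeVec (i • k) = (i : ℝ) • latticeVec k := by
  ext j; simp [latticeVec]

/-- `u` inherits from `U` the upper bounds of increments which hold at all lattice translates:
if `U (q + k) - U (p + k) ≤ b` for all `k ∈ ℤⁿ`, then `u q - u p ≤ b`. All averages of lattice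
translates of `U` have this property. -/
def InheritsIncrementBounds (U u : Eucl n → ℝ) : Prop :=
  ∀ (p q : Eucl n) (b : ℝ),
    (∀ k : Fin n → ℤ, U (q + latticeVec k) - U (p + latticeVec k) ≤ b) → u q - u p ≤ b

lemma InheritsIncrementBounds.refl (U : Eucl n → ℝ) : InheritsIncrementBounds U U :=
  fun p q b h => by simpa [latticeVec_zero] using h 0

lemma InheritsIncrementBounds.trans {U u u' : Eucl n → ℝ} (h : InheritsIncrementBounds U u)
    (h' : InheritsIncrementBounds u u') : InheritsIncrementBounds U u' := fun p q b hb =>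
  h' p q b fun k => h _ _ b fun l => by
    simpa only [add_assoc, ← latticeVec_add] using hb (k + l)

lemma InheritsIncrementBounds.eq {U u : Eucl n → ℝ} (h : InheritsIncrementBounds U u)
    {p q : Eucl n} {c : ℝ}
    (hc : ∀ k : Fin n → ℤ, U (q + latticeVec k) - U (p + latticeVec k) = c) : u q - u p = c :=
  le_antisymm (h p q c fun k => (hc k).le) (by
    have := h q p (-c) fun k => by rw [← hc k, neg_sub]
    linarith)

lemma InheritsIncrementBounds.lipschitzWith {U u : Eucl n → ℝ} (h : InheritsIncrementBounds U u)
    {L : ℝ≥0} (hU : LipschitzWith L U) : LipschitzWith L u :=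
  LipschitzWith.of_le_add_mul L fun p q => by
    have := h q p (L * dist p q) fun k => by
      have := hU.le_add_mul (p + latticeVec k) (q + latticeVec k)
      rw [dist_add_right] at this
      linarith
    linarith

/-- Averaging over the translates by the multiples of one lattice vector `k`: a limit along an
ultrafilter of the Cesàro means of `U (p + i k) - U (i k)` has constant increments along `k`. -/
lemma exists_inherits_const_increment {U : Eucl n → ℝ} {L : ℝ≥0} (hU : LipschitzWith L U)
    (k : Fin n → ℤ) : ∃ u, InheritsIncrementBounds U u ∧
      ∃ c, ∀ p, u (p + latticeVec k) = u p + c := by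
  set e := latticeVec k with he
  let d : ℕ → Eucl n → ℝ := fun i p => U (p + (i : ℝ) • e) - U ((i : ℝ) • e)
  let s : ℕ → Eucl n → ℝ := fun N p => ((N : ℝ) + 1)⁻¹ * ∑ i ∈ Finset.range (N + 1), d i p
  have hd : ∀ i p, ‖d i p‖ ≤ L * ‖p‖ := fun i p => by
    have := hU.dist_le_mul (p + (i : ℝ) • e) ((i : ℝ) • e)
    rwa [dist_eq_norm, dist_eq_norm, add_sub_cancel_right] at this
  have hN : ∀ N : ℕ, (0 : ℝ) < (N : ℝ) + 1 := fun N => by positivity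
  have hs : ∀ p N, s N p ∈ Icc (-(L * ‖p‖)) (L * ‖p‖) := fun p N => by
    have : ‖s N p‖ ≤ L * ‖p‖ := by
      rw [norm_mul, norm_inv, Real.norm_of_nonneg (hN N).le, inv_mul_le_iff₀ (hN N)]
      refine (norm_sum_le_of_le _ fun i _ => hd i p).trans (le_of_eq ?_)
      simp
    exact abs_le.1 this
  have hlim : ∀ p, ∃ a, Tendsto (fun N => s N p) (hyperfilter ℕ) (𝓝 a) := fun p => by
    obtain ⟨a, _, ha⟩ := (isCompact_Icc (a := -(L * ‖p‖)) (b := L * ‖p‖)).ultrafilter_le_nhds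
      ((hyperfilter ℕ).map fun N => s N p)
      (by
        rw [Ultrafilter.coe_map, le_principal_iff, mem_map]
        exact univ_mem' (hs p))
    exact ⟨a, ha⟩
  choose u hu using hlim
  refine ⟨u, fun p q b hb => le_of_tendsto' ((hu q).sub (hu p)) fun N => ?_,
    u e - u 0, fun p => ?_⟩
  · rw [← mul_sub, ← Finset.sum_sub_distrib, inv_mul_le_iff₀ (hN N)]
    calc _ ≤ ∑ _i ∈ Finset.range (N + 1), b := Finset.sum_le_sum fun i _ => by
          have := hb (i • k)
          rw [latticeVec_nsmul] at this
          simp only [d]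
          linarith
      _ = _ := by simp
  · -- the increments along `e` telescope, and their dependence on `p` disappears in the mean
    have htel : ∀ N p, s N (p + e) - s N p =
        ((N : ℝ) + 1)⁻¹ * (U (p + ((N + 1 : ℕ) : ℝ) • e) - U p) := fun N p => by
      have := Finset.sum_range_sub (fun i : ℕ => U (p + (i : ℝ) • e)) (N + 1)
      simp only [Nat.cast_zero, zero_smul, add_zero] at this
      simp only [s]
      rw [← mul_sub, ← Finset.sum_sub_distrib, ← this]
      congr 1
      refine Finset.sum_congr rfl fun i _ => ?_
      simp only [d, sub_sub_sub_cancel_right, Nat.cast_succ, add_smul, one_smul]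
      congr 2
      abel
    have h1 : Tendsto (fun N => s N (p + e) - s N p - (s N (0 + e) - s N 0)) atTop (𝓝 0) := by
      refine squeeze_zero_norm (a := fun N : ℕ => 2 * (L * ‖p‖) * (1 / ((N : ℝ) + 1)))
        (fun N => ?_) ?_
      · rw [htel, htel, ← mul_sub, norm_mul, norm_inv, Real.norm_of_nonneg (hN N).le, mul_comm,
          one_div]
        refine mul_le_mul_of_nonneg_right ?_ (inv_nonneg.2 (hN N).le)
        have h2 := hd (N + 1) p
        have h3 := hd 0 p
        simp only [d, Nat.cast_zero, zero_smul, add_zero] at h2 h3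
        have h4 : U (p + ((N + 1 : ℕ) : ℝ) • e) - U p - (U (0 + ((N + 1 : ℕ) : ℝ) • e) - U 0) =
            (U (p + ((N + 1 : ℕ) : ℝ) • e) - U (((N + 1 : ℕ) : ℝ) • e)) - (U p - U 0) := by
          rw [zero_add]; ring
        rw [h4, two_mul]
        exact (norm_sub_le _ _).trans (add_le_add h2 h3)
      · simpa using tendsto_one_div_add_atTop_nhds_zero_nat.const_mul (2 * (L * ‖p‖))
    have h2 := tendsto_nhds_unique (h1.mono_left Nat.hyperfilter_le_atTop)
      (((hu (p + e)).sub (hu p)).sub ((hu (0 + e)).sub (hu 0)))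
    rw [zero_add] at h2
    linarith

/-- A Lipschitz function can be averaged over the lattice so as to have constant increments along
all lattice vectors, that is, a periodic gradient. -/
theorem exists_inherits_const_increments {U : Eucl n → ℝ} {L : ℝ≥0} (hU : LipschitzWith L U) :
    ∃ u, InheritsIncrementBounds U u ∧
      ∀ k : Fin n → ℤ, ∃ c, ∀ p, u (p + latticeVec k) = u p + c := by
  have key : ∀ s : Finset (Fin n), ∃ u, InheritsIncrementBounds U u ∧
      ∀ i ∈ s, ∃ c, ∀ p, u (p + latticeVec (Pi.single i 1)) = u p + c := fun s => by
    induction s using Finset.induction_on with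
    | empty => exact ⟨U, .refl U, by simp⟩
    | insert i s _ ih =>
      obtain ⟨u, hu, hs⟩ := ih
      obtain ⟨u', hu', hi⟩ := exists_inherits_const_increment (hu.lipschitzWith hU) (Pi.single i 1)
      refine ⟨u', hu.trans hu', fun j hj => ?_⟩
      rcases Finset.mem_insert.1 hj with rfl | hj
      · exact hi
      · obtain ⟨c, hc⟩ := hs j hj
        refine ⟨c, fun p => ?_⟩
        have := hu'.eq (p := p) (q := p + latticeVec (Pi.single j 1)) (c := c) fun k => by
          rw [add_right_comm, hc]; ring
        linarith
  obtain ⟨u, hu, h⟩ := key Finset.univ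
  refine ⟨u, hu, fun k => ?_⟩
  let G : AddSubgroup (Fin n → ℤ) :=
    { carrier := {k | ∃ c, ∀ p, u (p + latticeVec k) = u p + c}
      zero_mem' := ⟨0, fun p => by simp [latticeVec_zero]⟩
      add_mem' := by
        rintro k l ⟨c, hc⟩ ⟨c', hc'⟩
        exact ⟨c + c', fun p => by rw [latticeVec_add, ← add_assoc, hc', hc, add_assoc]⟩
      neg_mem' := by
        rintro k ⟨c, hc⟩
        refine ⟨-c, fun p => ?_⟩
        have := hc (p + latticeVec (-k))
        rw [latticeVec_neg, neg_add_cancel_right] at this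
        rw [latticeVec_neg]
        linarith }
  have hG : ∀ i, (Pi.single i (k i) : Fin n → ℤ) ∈ G := fun i => by
    have : (Pi.single i (k i) : Fin n → ℤ) = k i • Pi.single i 1 := by
      rw [← Pi.single_smul]; simp
    rw [this]
    exact G.zsmul_mem (h i (Finset.mem_univ i)) _
  have := G.sum_mem fun i (_ : i ∈ Finset.univ) => hG i
  rwa [Finset.univ_sum_single] at this

end Average

/-! ### The potential with gradient `e^{-w} ∇^⊥ v` -/

section Potential

variable {v w : Eucl 2 → ℝ} {Z Y : ℝ → Eucl 2 → Eucl 2} {K : ℝ≥0}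

/-- If `w` is locally Lipschitz and `∇w · ∇v = Δv`, then `e^{-w} ∇^⊥ v` is a gradient: its curl is
`e^{-w} (Δv - ∇w · ∇v) = 0` at every point where `w` is differentiable, and almost every point is
such by Rademacher's theorem. -/
theorem exists_potential (hv : ContDiff ℝ 3 v) (hZ : IsFlow (∇ v) Z) (hw : LocallyLipschitz w)
    (hwZ : ∀ p, HasDerivAt (fun t => w (Z t p)) ((Δ v) p) 0) :
    ∃ U : Eucl 2 → ℝ, ∀ p,
      HasFDerivAt U (Real.exp (-w p) • innerSL ℝ (perp (∇ v p))) p := by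
  let e : ℝ × ℝ →L[ℝ] Eucl 2 := LinearMap.toContinuousLinearMap
    { toFun := fun q => !₂[q.1, q.2]
      map_add' := fun x y => by ext i; fin_cases i <;> simp
      map_smul' := fun c x => by ext i; fin_cases i <;> simp }
  let e' : Eucl 2 →L[ℝ] ℝ × ℝ :=
    (EuclideanSpace.proj (0 : Fin 2)).prod (EuclideanSpace.proj (1 : Fin 2))
  have hee' : ∀ p, e (e' p) = p := fun p => by ext i; fin_cases i <;> rfl
  have he0 : e (1, 0) = EuclideanSpace.single 0 1 := by ext i; fin_cases i <;> simp [e]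
  have he1 : e (0, 1) = EuclideanSpace.single 1 1 := by ext i; fin_cases i <;> simp [e]
  have hg : ∀ i, ContDiff ℝ 1 (partialDeriv i v) :=
    contDiff_partialDeriv (k := 3) (m := 1) hv (by norm_num)
  have hwe : LocallyLipschitz fun q => w (e q) :=
    LocallyLipschitz.comp hw (LipschitzWith.locallyLipschitz e.lipschitz)
  have hΦ : ∀ i, LocallyLipschitz fun q => Real.exp (-w (e q)) * partialDeriv i v (e q) := fun i =>
    have h : ContDiff ℝ 1 fun r : ℝ × (ℝ × ℝ) => Real.exp (-r.1) * partialDeriv i v (e r.2) :=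
      (contDiff_fst.neg.exp).mul ((hg i).comp (e.contDiff.comp contDiff_snd))
    LocallyLipschitz.comp (ContDiff.locallyLipschitz h)
      (LocallyLipschitz.prodMk hwe LocallyLipschitz.id)
  have hΦ' : LocallyLipschitz fun q => -(Real.exp (-w (e q)) * partialDeriv 1 v (e q)) :=
    LocallyLipschitz.neg (hΦ 1)
  obtain ⟨U, hU⟩ := exists_potential_of_ae_curl_eq_zero hΦ' (hΦ 0) (by
    filter_upwards [LocallyLipschitz.ae_differentiableAt (μ := volume) hwe] with q hq
    obtain ⟨W, hW⟩ := hq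
    have hd : ∀ i, HasFDerivAt (fun q => partialDeriv i v (e q))
        ((fderiv ℝ (partialDeriv i v) (e q)).comp e) q := fun i =>
      HasFDerivAt.comp q ((hg i).differentiable one_ne_zero _).hasFDerivAt e.hasFDerivAt
    have htransport : W (e' (∇ v (e q))) = (Δ v) (e q) := by
      have hc : HasDerivAt (fun t => e' (Z t (e q))) (e' (∇ v (e q))) 0 := by
        have := (hZ (e q)).2 0
        rw [(hZ (e q)).1] at this
        exact e'.hasFDerivAt.comp_hasDerivAt 0 this
      have hW' : HasFDerivAt (fun q => w (e q)) W (e' (Z 0 (e q))) := by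
        rw [(hZ (e q)).1]; exact hW
      have h := hW'.comp_hasDerivAt 0 hc
      simp only [Function.comp_def, hee'] at h
      exact h.unique (hwZ (e q))
    refine ⟨_, _, ((hW.neg.exp).mul (hd 1)).neg, (hW.neg.exp).mul (hd 0), ?_⟩
    have hsplit : W (e' (∇ v (e q))) = partialDeriv 0 v (e q) * W (1, 0) +
        partialDeriv 1 v (e q) * W (0, 1) := by
      have : e' (∇ v (e q)) = partialDeriv 0 v (e q) • ((1, 0) : ℝ × ℝ) +
          partialDeriv 1 v (e q) • ((0, 1) : ℝ × ℝ) := by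
        simp [e', gradient_apply]
      rw [this, map_add, map_smul, map_smul, smul_eq_mul, smul_eq_mul]
    rw [hsplit, laplacian_eq_sum_partialDeriv (hv.of_le (by norm_num)), Fin.sum_univ_two]
      at htransport
    simp only [partialDeriv] at htransport
    simp only [neg_apply, add_apply,
      smul_apply, ContinuousLinearMap.comp_apply, smul_eq_mul, he0, he1,
      partialDeriv]
    linear_combination Real.exp (-w (e q)) * htransport)
  refine ⟨fun p => U (e' p), fun p => ?_⟩
  refine ((hU (e' p)).comp p e'.hasFDerivAt).congr_fderiv ?_
  ext x
  simp only [hee']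
  simp [e', PiLp.inner_apply, Fin.sum_univ_two, gradient_apply]
  ring

/-- If `w` is bounded, then so is `∇u = e^{-w} ∇^⊥ v`, and the averages of `u` over the lattice
provide a Lipschitz function with periodic gradient which is constant along the trajectories of
`∇v` and increases at a positive rate along those of `∇^⊥ v`. -/
theorem exists_periodic_potential (hv : ContDiff ℝ 3 v) (hper : CubePeriodic (∇ v))
    (hF : LipschitzWith K (∇ v)) {m M : ℝ} (hm0 : 0 < m) (hm : ∀ p, m ≤ ‖∇ v p‖ ^ 2)
    (hM : ∀ p, ‖∇ v p‖ ≤ M) (hZ : IsFlow (∇ v) Z) (hY : IsFlow (fun p => perp (∇ v p)) Y)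
    (hw : LocallyLipschitz w) (hwZ : ∀ p, HasDerivAt (fun t => w (Z t p)) ((Δ v) p) 0)
    {C : ℝ} (hC : ∀ p, |w p| ≤ C) :
    ∃ (u : Eucl 2 → ℝ) (L : ℝ≥0) (c : ℝ), 0 < c ∧ LipschitzWith L u ∧
      (∀ k : Fin 2 → ℤ, ∃ a, ∀ p, u (p + latticeVec k) = u p + a) ∧
      (∀ p t, u (Z t p) = u p) ∧ ∀ p t, 0 ≤ t → c * t ≤ u (Y t p) - u p := by
  obtain ⟨U, hU⟩ := exists_potential hv hZ hw hwZ
  have hM0 : 0 ≤ M := (norm_nonneg _).trans (hM 0)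
  have hUL : LipschitzWith (NNReal.mk (Real.exp C * M) (by positivity)) U := by
    refine lipschitzWith_of_nnnorm_fderiv_le (fun p => (hU p).differentiableAt) fun p => ?_
    rw [(hU p).fderiv, ← NNReal.coe_le_coe, coe_nnnorm, norm_smul, innerSL_apply_norm, norm_perp,
      Real.norm_of_nonneg (Real.exp_pos _).le]
    have := neg_le_abs (w p)
    exact mul_le_mul (Real.exp_le_exp.2 (this.trans (hC p))) (hM p) (norm_nonneg _)
      (Real.exp_pos _).le
  have hUZ : ∀ p t, U (Z t p) = U p := fun p t => by
    have hd : ∀ t, HasDerivAt (fun t => U (Z t p)) 0 t := fun t => by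
      refine ((hU (Z t p)).comp_hasDerivAt t ((hZ p).2 t)).congr_deriv ?_
      rw [smul_apply, innerSL_apply_apply, inner_perp_self, smul_zero]
    have := is_const_of_deriv_eq_zero (fun t => (hd t).differentiableAt) (fun t => (hd t).deriv) t 0
    simpa only [(hZ p).1] using this
  have hUY : ∀ p t, 0 ≤ t → Real.exp (-C) * m * t ≤ U (Y t p) - U p := fun p t ht => by
    have hd : ∀ t, HasDerivAt (fun t => U (Y t p))
        (Real.exp (-w (Y t p)) * ‖∇ v (Y t p)‖ ^ 2) t := fun t => by
      refine ((hU (Y t p)).comp_hasDerivAt t ((hY p).2 t)).congr_deriv ?_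
      rw [smul_apply, innerSL_apply_apply, real_inner_self_eq_norm_sq,
        norm_perp, smul_eq_mul]
    have := mul_sub_le_image_sub_of_le_deriv (C := Real.exp (-C) * m)
      (fun t => (hd t).differentiableAt) (fun t => by
        rw [(hd t).deriv]
        exact mul_le_mul (Real.exp_le_exp.2 (neg_le_neg ((le_abs_self _).trans (hC _))))
          (hm _) hm0.le (Real.exp_pos _).le) ht
    simpa only [(hY p).1, sub_zero] using this
  have hFY : LipschitzWith (‖perp‖₊ * K) fun p => perp (∇ v p) := perp.lipschitz.comp hF
  have hperY : CubePeriodic fun p => perp (∇ v p) := hper.comp perp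
  obtain ⟨u, hu, hinc⟩ := exists_inherits_const_increments hUL
  refine ⟨u, _, Real.exp (-C) * m, by positivity, hu.lipschitzWith hUL, hinc, fun p t => ?_,
    fun p t ht => ?_⟩
  · refine sub_eq_zero.1 (hu.eq fun k => ?_)
    rw [← hZ.add_latticeVec hF hper, hUZ, sub_self]
  · have := hu (Y t p) p (-(Real.exp (-C) * m * t)) fun k => by
      rw [← hY.add_latticeVec hFY hperY]
      linarith [hUY (p + latticeVec k) t ht]
    linarith

end Potential

/-! ### Realizability from a potential with periodic gradient -/

section Realizability

variable {n : ℕ}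

lemma measurable_gradient (u : Eucl n → ℝ) : Measurable (∇ u) :=
  (InnerProductSpace.toDual ℝ (Eucl n)).symm.continuous.measurable.comp (measurable_fderiv ℝ u)

lemma LipschitzWith.norm_gradient_le {u : Eucl n → ℝ} {L : ℝ≥0} (hu : LipschitzWith L u)
    (x : Eucl n) : ‖∇ u x‖ ≤ L := by
  rw [norm_gradient]
  exact norm_fderiv_le_of_lipschitz ℝ hu

lemma LipschitzWith.memLp_gradient {u : Eucl n → ℝ} {L : ℝ≥0} (hu : LipschitzWith L u) :
    MemLp (∇ u) ∞ :=
  memLp_top_of_bound (measurable_gradient u).aestronglyMeasurable L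
    (Eventually.of_forall (LipschitzWith.norm_gradient_le hu))

/-- The almost everywhere defined gradient of a Lipschitz function is its weak gradient. -/
lemma LipschitzWith.hasWeakGradient {u : Eucl n → ℝ} {L : ℝ≥0} (hu : LipschitzWith L u) :
    HasWeakGradient u (∇ u) := by
  refine ⟨hu.continuous.locallyIntegrable,
    (LipschitzWith.memLp_gradient hu).locallyIntegrable le_top, fun φ hφ hφc i => ?_⟩
  obtain ⟨D, hD⟩ := (hφ.of_le (by exact_mod_cast le_top)).lipschitzWith_of_hasCompactSupport
    hφc (n := 1) one_ne_zero
  have h := hu.integral_lineDeriv_mul_eq (μ := volume) hD hφc (EuclideanSpace.single i 1)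
  have h1 : ∫ x, lineDeriv ℝ u x (EuclideanSpace.single i 1) * φ x = ∫ x, (∇ u x) i * φ x := by
    refine integral_congr_ae ?_
    filter_upwards [hu.ae_differentiableAt (μ := volume)] with x hx
    rw [hx.lineDeriv_eq_fderiv, gradient_apply, partialDeriv]
  have h2 : ∀ x, lineDeriv ℝ φ x (-EuclideanSpace.single i 1) = -partialDeriv i φ x := fun x => by
    rw [((hφ.differentiable (by simp)) x).lineDeriv_eq_fderiv, map_neg, partialDeriv]
  simp only [h1, h2, neg_mul] at h
  rw [h, integral_neg, neg_neg]
  simp only [mul_comm]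

lemma proj_latticeVec (k : Fin 3 → ℤ) : proj (latticeVec k) = latticeVec ![k 0, k 1] := by
  ext i; fin_cases i <;> simp [latticeVec]

lemma le_of_forall_mul_le_sub {h : ℝ → ℝ} {c d : ℝ} (hd : HasDerivAt h d 0)
    (hc : ∀ t, 0 ≤ t → c * t ≤ h t - h 0) : c ≤ d := by
  refine ge_of_tendsto (hd.tendsto_slope_zero_right) ?_
  filter_upwards [self_mem_nhdsWithin] with t ht
  have ht : 0 < t := ht
  have := hc t ht.le
  rw [zero_add, smul_eq_mul, le_inv_mul_iff₀ ht]
  linarith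

variable {v u : Eucl 2 → ℝ} {α : ℝ → ℝ} {Z Y : ℝ → Eucl 2 → Eucl 2}

/-- At the points where the function `(x, y, z) ↦ u(x, y)` is differentiable, its gradient is
orthogonal to `(∇v, 0)` and to the vertical direction. It is thus a multiple of `(∇^⊥ v, 0)`, and
its component along this vector is at least the rate of increase of `u` along `∇^⊥ v`. -/
lemma gradient_comp_proj (hZ : IsFlow (∇ v) Z) (hY : IsFlow (fun p => perp (∇ v p)) Y)
    {c : ℝ} (huZ : ∀ p t, u (Z t p) = u p) (huY : ∀ p t, 0 ≤ t → c * t ≤ u (Y t p) - u p)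
    {x : Eucl 3} (hx : DifferentiableAt ℝ (fun x => u (proj x)) x) :
    c ≤ ⟪∇ (fun x => u (proj x)) x, lift (perp (∇ v (proj x))) 0⟫_ℝ ∧
      ‖∇ v (proj x)‖ ^ 2 • ∇ (fun x => u (proj x)) x =
        ⟪∇ (fun x => u (proj x)) x, lift (perp (∇ v (proj x))) 0⟫_ℝ •
          lift (perp (∇ v (proj x))) 0 := by
  set G := ∇ (fun x => u (proj x)) x with hG
  have hcurve : ∀ (γ : ℝ → Eucl 3) (γ' : Eucl 3), γ 0 = x → HasDerivAt γ γ' 0 →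
      HasDerivAt (fun t => u (proj (γ t))) ⟪G, γ'⟫_ℝ 0 := fun γ γ' h0 hγ => by
    rw [hG, ← fderiv_eq_inner_gradient]
    have hx' : HasFDerivAt (fun x => u (proj x)) (fderiv ℝ (fun x => u (proj x)) x) (γ 0) := by
      rw [h0]; exact hx.hasFDerivAt
    exact hx'.comp_hasDerivAt 0 hγ
  have h1 : ⟪G, lift (∇ v (proj x)) 0⟫_ℝ = 0 := by
    have hd := (hZ (proj x)).2 0
    rw [(hZ _).1] at hd
    have h := hcurve (fun t => lift (Z t (proj x)) (x 2)) _
      (by simp only [(hZ _).1, lift_proj]) (hasDerivAt_lift hd (hasDerivAt_const 0 (x 2)))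
    simp only [proj_lift, huZ] at h
    exact h.unique (hasDerivAt_const _ _)
  have h2 : ⟪G, lift 0 1⟫_ℝ = 0 := by
    have h := hcurve (fun t => lift (proj x) (x 2 + t)) _
      (by simp only [add_zero, lift_proj])
      (hasDerivAt_lift (hasDerivAt_const 0 (proj x)) ((hasDerivAt_id (0 : ℝ)).const_add (x 2)))
    simp only [proj_lift] at h
    exact h.unique (hasDerivAt_const _ _)
  have h3 : c ≤ ⟪G, lift (perp (∇ v (proj x))) 0⟫_ℝ := by
    have hd := (hY (proj x)).2 0
    rw [(hY _).1] at hd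
    have h := hcurve (fun t => lift (Y t (proj x)) (x 2)) _
      (by simp only [(hY _).1, lift_proj]) (hasDerivAt_lift hd (hasDerivAt_const 0 (x 2)))
    simp only [proj_lift] at h
    refine le_of_forall_mul_le_sub h fun t ht => ?_
    simpa only [(hY _).1] using huY (proj x) t ht
  refine ⟨h3, ?_⟩
  simp only [PiLp.inner_apply, Fin.sum_univ_three, lift_apply_zero, lift_apply_one, lift_apply_two,
    RCLike.inner_apply, conj_trivial, zero_mul, add_zero, PiLp.zero_apply, one_mul, zero_add,
    perp_apply_zero, perp_apply_one] at h1 h2 ⊢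
  ext i
  fin_cases i
  · simp [norm_sq_two]
    linear_combination (∇ v (proj x)) 0 * h1
  · simp [norm_sq_two]
    linear_combination (∇ v (proj x)) 1 * h1
  · simp [h2]

/-- A Lipschitz function of the plane with a periodic gradient, constant along the trajectories of
`∇v` and increasing at a positive rate along those of `∇^⊥ v`, is a potential for `j`. With `d` the
component of its gradient along `∇^⊥ v`, the conductivity is `α |∇v|² / d`. -/
theorem realizableInTorus_of_potential (hα : Continuous α) {a A m M c : ℝ} (ha0 : 0 < a)
    (ha : ∀ z, a ≤ α z) (hA : ∀ z, α z ≤ A) (hα_per : Function.Periodic α 1)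
    (hg : Continuous (∇ v)) (hper : CubePeriodic (∇ v)) (hm0 : 0 < m)
    (hm : ∀ p, m ≤ ‖∇ v p‖ ^ 2) (hM : ∀ p, ‖∇ v p‖ ≤ M) (hZ : IsFlow (∇ v) Z)
    (hY : IsFlow (fun p => perp (∇ v p)) Y) {L : ℝ≥0} (hu : LipschitzWith L u)
    (hinc : ∀ k : Fin 2 → ℤ, ∃ b, ∀ p, u (p + latticeVec k) = u p + b) (hc : 0 < c)
    (huZ : ∀ p t, u (Z t p) = u p) (huY : ∀ p t, 0 ≤ t → c * t ≤ u (Y t p) - u p) :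
    RealizableInTorus (planarField α v) := by
  set u₃ : Eucl 3 → ℝ := fun x => u (proj x) with hu₃
  set d : Eucl 3 → ℝ := fun x => ⟪∇ u₃ x, lift (perp (∇ v (proj x))) 0⟫_ℝ with hd
  have hu₃L : LipschitzWith (L * ‖proj‖₊) u₃ := hu.comp proj.lipschitz
  have hgper : CubePeriodic fun x : Eucl 3 => ∇ v (proj x) := fun k x => by
    simp only [map_add, proj_latticeVec, hper _ (proj x)]
  have hGper : CubePeriodic (∇ u₃) := fun k x => by
    obtain ⟨b, hb⟩ := hinc ![k 0, k 1]
    have : (fun y => u₃ (y + latticeVec k)) = fun y => u₃ y + b := by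
      funext y
      simp only [hu₃, map_add, proj_latticeVec, hb]
    rw [gradient, ← fderiv_comp_add_right, this, fderiv_add_const, gradient]
  have hαper : CubePeriodic fun x : Eucl 3 => α (x 2) := fun k x => by
    simpa [latticeVec] using hα_per.int_mul (k 2) (x 2)
  have hM0 : 0 ≤ M := (norm_nonneg _).trans (hM 0)
  have hnorm : ∀ p, ‖lift (perp (∇ v p)) 0‖ ≤ M := fun p => by
    refine le_of_eq_of_le ?_ (hM p)
    rw [← sq_eq_sq₀ (norm_nonneg _) (norm_nonneg _), norm_sq_three, norm_sq_two]
    simp [add_comm]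
  have hdle : ∀ x, d x ≤ (L * ‖proj‖₊ : ℝ≥0) * M := fun x =>
    (real_inner_le_norm _ _).trans (mul_le_mul (LipschitzWith.norm_gradient_le hu₃L x)
      (hnorm _) (norm_nonneg _) NNReal.zero_le_coe)
  have hpt : ∀ᵐ x : Eucl 3, c ≤ d x ∧
      ‖∇ v (proj x)‖ ^ 2 • ∇ u₃ x = d x • lift (perp (∇ v (proj x))) 0 := by
    filter_upwards [hu₃L.ae_differentiableAt (μ := volume)] with x hx
    exact gradient_comp_proj hZ hY huZ huY hx
  have hcoord : ∀ i : Fin 3, Continuous fun x : Eucl 3 => x i := fun i => by fun_prop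
  have hgc : Continuous fun x : Eucl 3 => ∇ v (proj x) := hg.comp proj.continuous
  have hdm : Measurable d := by
    refine (measurable_gradient u₃).inner (Continuous.measurable ?_)
    refine (PiLp.continuous_toLp 2 _).comp (continuous_pi fun i => ?_)
    fin_cases i
    · exact (EuclideanSpace.proj (0 : Fin 2) : Eucl 2 →L[ℝ] ℝ).continuous.comp
        (perp.continuous.comp hgc)
    · exact (EuclideanSpace.proj (1 : Fin 2) : Eucl 2 →L[ℝ] ℝ).continuous.comp
        (perp.continuous.comp hgc)
    · exact continuous_const
  set σ : Eucl 3 → ℝ := fun x => α (x 2) * ‖∇ v (proj x)‖ ^ 2 / d x with hσ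
  have hσm : Measurable σ :=
    (((hα.comp (hcoord 2)).mul (hgc.norm.pow 2)).measurable).div hdm
  have hσper : CubePeriodic σ := fun k x => by
    simp only [hσ, hd, hGper k x, hgper k x, hαper k x]
  have hnum : ∀ x : Eucl 3, a * m ≤ α (x 2) * ‖∇ v (proj x)‖ ^ 2 := fun x =>
    mul_le_mul (ha _) (hm _) hm0.le (ha0.le.trans (ha _))
  have hnum' : ∀ x : Eucl 3, α (x 2) * ‖∇ v (proj x)‖ ^ 2 ≤ A * M ^ 2 := fun x =>
    mul_le_mul (hA _) (pow_le_pow_left₀ (norm_nonneg _) (hM _) 2) (by positivity)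
      ((ha0.le.trans (ha 0)).trans (hA 0))
  have ham : 0 < a * m := mul_pos ha0 hm0
  refine ⟨σ, ?_, ?_, ?_, fun k => Eventually.of_forall (hσper k), u₃, ∇ u₃, fun K hK => ?_,
    LipschitzWith.hasWeakGradient hu₃L, LipschitzWith.memLp_gradient hu₃L,
    fun k => Eventually.of_forall (hGper k), ?_⟩
  · filter_upwards [hpt] with x hx
    exact div_pos (ham.trans_le (hnum x)) (hc.trans_le hx.1)
  · refine memLp_top_of_bound hσm.aestronglyMeasurable (A * M ^ 2 / c) ?_
    filter_upwards [hpt] with x hx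
    rw [Real.norm_of_nonneg (div_pos (ham.trans_le (hnum x)) (hc.trans_le hx.1)).le]
    exact div_le_div₀ (ham.le.trans ((hnum x).trans (hnum' x))) (hnum' x) hc hx.1
  · refine memLp_top_of_bound hσm.inv.aestronglyMeasurable
      ((L * ‖proj‖₊ : ℝ≥0) * M / (a * m)) ?_
    filter_upwards [hpt] with x hx
    rw [hσ, inv_div, Real.norm_of_nonneg (div_pos (hc.trans_le hx.1) (ham.trans_le (hnum x))).le]
    exact div_le_div₀ (by positivity) (hdle x) ham (hnum x)
  · obtain ⟨B, hB⟩ := hK.exists_bound_of_continuousOn hu₃L.continuous.continuousOn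
    refine memLp_top_of_bound hu₃L.continuous.aestronglyMeasurable B ?_
    filter_upwards [ae_restrict_mem hK.measurableSet] with x hx using hB x hx
  · filter_upwards [hpt] with x hx
    have hd0 : d x ≠ 0 := (hc.trans_le hx.1).ne'
    rw [planarField_eq, hσ]
    simp only
    rw [div_eq_mul_inv, mul_right_comm, mul_smul, hx.2, smul_smul, mul_assoc, inv_mul_cancel₀ hd0,
      mul_one]

end Realizability

/-! ### Realizability with a conductivity of class `C¹` bounds `w_v` -/

section Converse

variable {n : ℕ}

/-- A closed condition which holds almost everywhere holds everywhere. -/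
lemma forall_of_ae_of_isClosed {s : Set (Eucl n)} (hs : IsClosed s)
    (h : ∀ᵐ x : Eucl n, x ∈ s) (x : Eucl n) : x ∈ s := by
  have hd : Dense s := Measure.dense_of_ae h
  rw [← hs.closure_eq, hd.closure_eq]
  exact mem_univ x

lemma partialDeriv_comm {φ : Eucl n → ℝ} (hφ : ContDiff ℝ 2 φ) (i k : Fin n) (x : Eucl n) :
    partialDeriv i (partialDeriv k φ) x = partialDeriv k (partialDeriv i φ) x := by
  have hd : DifferentiableAt ℝ (fderiv ℝ φ) x :=
    (hφ.fderiv_right (m := 1) (by norm_num)).differentiable one_ne_zero x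
  have h : ∀ i k : Fin n, partialDeriv i (partialDeriv k φ) x =
      fderiv ℝ (fderiv ℝ φ) x (EuclideanSpace.single i 1) (EuclideanSpace.single k 1) := by
    intro i k
    have h : partialDeriv k φ = fun y => fderiv ℝ φ y (EuclideanSpace.single k 1) := rfl
    rw [h, partialDeriv, fderiv_clm_apply hd (differentiableAt_const _)]
    simp
  rw [h, h]
  exact (hφ.contDiffAt.isSymmSndFDerivAt (by simp)).eq _ _

/-- A weak gradient of class `C¹` is curl free in the classical sense. -/
lemma HasWeakGradient.partialDeriv_comm {u : Eucl n → ℝ} {G F : Eucl n → Eucl n}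
    (h : HasWeakGradient u G) (hGF : ∀ᵐ x : Eucl n, G x = F x) (hF : ContDiff ℝ 1 F)
    (i k : Fin n) (x : Eucl n) :
    partialDeriv k (fun y => F y i) x = partialDeriv i (fun y => F y k) x := by
  have hFi : ∀ i, ContDiff ℝ 1 fun y => F y i := fun i => contDiff_euclidean.1 hF i
  have hFc : ∀ i k, Continuous (partialDeriv k fun y => F y i) := fun i k =>
    (contDiff_partialDeriv (k := 1) (m := 0) (hFi i) (by norm_num) k).continuous
  have key : ∀ φ : Eucl n → ℝ, ContDiff ℝ ∞ φ → HasCompactSupport φ → ∀ i k : Fin n,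
      ∫ x, u x * partialDeriv i (partialDeriv k φ) x =
        ∫ x, φ x * partialDeriv k (fun y => F y i) x := by
    intro φ hφ hφc i k
    have hψ : ContDiff ℝ ∞ (partialDeriv k φ) :=
      contDiff_partialDeriv (k := ⊤) (m := ⊤) hφ (by simp) k
    have hψc : HasCompactSupport (partialDeriv k φ) :=
      hφc.fderiv_apply ℝ (EuclideanSpace.single k 1)
    have hint : ∀ {f g : Eucl n → ℝ}, Continuous f → Continuous g → HasCompactSupport g →
        Integrable fun x => f x * g x := fun hf hg hgc =>
      (hf.mul hg).integrable_of_hasCompactSupport hgc.mul_left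
    rw [h.2.2 _ hψ hψc i]
    have h1 : ∫ x, G x i * partialDeriv k φ x = ∫ x, F x i * partialDeriv k φ x := by
      refine integral_congr_ae ?_
      filter_upwards [hGF] with x hx
      rw [hx]
    have h2 := integral_mul_fderiv_eq_neg_fderiv_mul_of_integrable (μ := volume)
      (f := fun x => F x i) (g := φ) (v := EuclideanSpace.single k 1)
      (hint (hFc i k) hφ.continuous hφc) (hint (hFi i).continuous hψ.continuous hψc)
      (hint (hFi i).continuous hφ.continuous hφc)
      (fun x _ => (hFi i).differentiable one_ne_zero x)
      (fun x _ => hφ.differentiable (by simp) x)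
    rw [h1]
    simp only [partialDeriv] at h2 ⊢
    rw [h2, neg_neg]
    simp only [mul_comm]
  have hc : Continuous fun x => partialDeriv k (fun y => F y i) x -
      partialDeriv i (fun y => F y k) x := (hFc i k).sub (hFc k i)
  have hae := ae_eq_zero_of_integral_contDiff_smul_eq_zero (μ := volume) hc.locallyIntegrable
    fun φ hφ hφc => by
      have hint : ∀ i k, Integrable fun x => φ x * partialDeriv k (fun y => F y i) x :=
        fun i k => (hφ.continuous.mul (hFc i k)).integrable_of_hasCompactSupport hφc.mul_right
      have hφ2 : ContDiff ℝ 2 φ := by exact_mod_cast contDiff_infty.1 hφ 2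
      simp only [smul_eq_mul, mul_sub]
      rw [integral_sub (hint i k) (hint k i), ← key φ hφ hφc i k, ← key φ hφ hφc k i]
      simp only [IsotropicRealizability.partialDeriv_comm hφ2 i k, sub_self]
  exact sub_eq_zero.1 (forall_of_ae_of_isClosed (isClosed_eq hc continuous_const) hae x)

variable {α : ℝ → ℝ} {v : Eucl 2 → ℝ} {Z : ℝ → Eucl 2 → Eucl 2} {τ : Eucl 2 → ℝ}

/-- If `j = σ ∇u` with `σ` of class `C¹`, then `j / σ` is curl free. Its vertical curl on the plane
`z = 0` shows that `log (α / σ)` has derivative `-Δv` along the trajectories of `∇v`, so that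
`w_v` is a difference of two values of this bounded function. -/
theorem exists_logConductivity_le (hα : ContDiff ℝ 2 α) (hα_per : Function.Periodic α 1)
    (hα_pos : ∀ z, 0 < α z) (hv : ContDiff ℝ 3 v) (hZ : IsFlow (∇ v) Z) {σ : Eucl 3 → ℝ}
    (hσ : ContDiff ℝ 1 σ) (hσ_per : CubePeriodic σ) (hσ_pos : ∀ x, 0 < σ x)
    (hreal : RealizableInTorusWith (planarField α v) σ) :
    ∃ C, ∀ p, |logConductivity v Z τ p| ≤ C := by
  obtain ⟨-, -, -, -, u, G, -, hG, -, -, hj⟩ := hreal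
  set r : Eucl 3 → ℝ := fun x => α (x 2) / σ x with hr
  have hcoord : ∀ i : Fin 3, ContDiff ℝ 1 fun x : Eucl 3 => x i := fun i =>
    (EuclideanSpace.proj i : Eucl 3 →L[ℝ] ℝ).contDiff
  have hrc : ContDiff ℝ 1 r :=
    ((hα.of_le (by norm_num)).comp (hcoord 2)).div hσ fun x => (hσ_pos x).ne'
  have hr_pos : ∀ x, 0 < r x := fun x => div_pos (hα_pos _) (hσ_pos x)
  have hr_per : CubePeriodic r := fun k x => by
    have : α ((x + latticeVec k) 2) = α (x 2) := by
      simpa [latticeVec] using hα_per.int_mul (k 2) (x 2)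
    simp only [hr, this, hσ_per k x]
  have hg : ∀ i, ContDiff ℝ 1 (partialDeriv i v) :=
    contDiff_partialDeriv (k := 3) (m := 1) hv (by norm_num)
  -- the field `j / σ`, in coordinates
  set F : Eucl 3 → Eucl 3 := fun x =>
    !₂[-(r x * partialDeriv 1 v (proj x)), r x * partialDeriv 0 v (proj x), 0] with hF
  have hrg : ∀ i, ContDiff ℝ 1 fun x => r x * partialDeriv i v (proj x) := fun i =>
    hrc.mul ((hg i).comp proj.contDiff)
  have hFc : ContDiff ℝ 1 F := contDiff_euclidean.2 fun i => by
    fin_cases i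
    exacts [(hrg 1).neg, hrg 0, contDiff_const]
  have hGF : ∀ᵐ x : Eucl 3, G x = F x := by
    filter_upwards [hj] with x hx
    have : G x = (σ x)⁻¹ • planarField α v x := by
      rw [hx, smul_smul, inv_mul_cancel₀ (hσ_pos x).ne', one_smul]
    rw [this]
    ext i
    fin_cases i <;> simp [planarField, hF, hr, proj_apply] <;> ring
  have hcurl : ∀ x, fderiv ℝ r x (lift (∇ v (proj x)) 0) = -(r x * (Δ v) (proj x)) := fun x => by
    have h := hG.partialDeriv_comm hGF hFc 0 1 x
    have hd : ∀ i, HasFDerivAt (fun y => r y * partialDeriv i v (proj y))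
        (r x • (fderiv ℝ (partialDeriv i v) (proj x)).comp proj +
          partialDeriv i v (proj x) • fderiv ℝ r x) x := fun i =>
      (hrc.differentiable one_ne_zero x).hasFDerivAt.mul
        (((hg i).differentiable one_ne_zero _).hasFDerivAt.comp x proj.hasFDerivAt)
    have h0 : partialDeriv 1 (fun y => F y 0) x = _ :=
      congrArg (fun A : Eucl 3 →L[ℝ] ℝ => A (EuclideanSpace.single 1 1)) (hd 1).neg.fderiv
    have h1 : partialDeriv 0 (fun y => F y 1) x = _ :=
      congrArg (fun A : Eucl 3 →L[ℝ] ℝ => A (EuclideanSpace.single 0 1)) (hd 0).fderiv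
    rw [h0, h1] at h
    have hsplit : (lift (∇ v (proj x)) 0 : Eucl 3) =
        partialDeriv 0 v (proj x) • EuclideanSpace.single 0 1 +
          partialDeriv 1 v (proj x) • EuclideanSpace.single 1 1 := by
      ext i
      fin_cases i <;> simp [lift, gradient_apply]
    rw [hsplit, map_add, map_smul, map_smul, laplacian_eq_sum_partialDeriv (hv.of_le (by norm_num)),
      Fin.sum_univ_two]
    simp only [neg_apply, add_apply, smul_apply, ContinuousLinearMap.comp_apply, smul_eq_mul,
      proj_single_zero, proj_single_one] at h ⊢
    simp only [partialDeriv] at h ⊢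
    linear_combination -h
  obtain ⟨B, -, hB⟩ := (hr_per.comp Real.log).exists_norm_le
    (hrc.continuous.log fun x => (hr_pos x).ne')
  refine ⟨B + B, fun p => ?_⟩
  have hderiv : ∀ t, HasDerivAt (fun t => Real.log (r (lift (Z t p) 0))) (-(Δ v) (Z t p)) t :=
    fun t => by
      have h1 := hasDerivAt_lift ((hZ p).2 t) (hasDerivAt_const t (0 : ℝ))
      have h2 := (hrc.differentiable one_ne_zero (lift (Z t p) 0)).hasFDerivAt.comp_hasDerivAt t h1
      have h3 := hcurl (lift (Z t p) 0)
      rw [proj_lift] at h3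
      rw [h3] at h2
      refine (h2.log (hr_pos _).ne').congr_deriv ?_
      have := (hr_pos (lift (Z t p) 0)).ne'
      simp only [Function.comp_apply]
      field_simp
  have hΔc : Continuous fun t => -(Δ v) (Z t p) :=
    ((contDiff_laplacian hv).continuous.comp (hZ.continuous_time p)).neg
  have hw : logConductivity v Z τ p =
      Real.log (r (lift (Z (τ p) p) 0)) - Real.log (r (lift (Z 0 p) 0)) := by
    rw [logConductivity, ← intervalIntegral.integral_neg]
    exact intervalIntegral.integral_eq_sub_of_hasDerivAt (fun t _ => hderiv t)
      (hΔc.intervalIntegrable _ _)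
  rw [hw]
  exact (abs_sub _ _).trans (add_le_add (hB _) (hB _))

end Converse

/-! ### The integral of `|curl j|² / |j|²` along the trajectories of `X₃` -/

section Trajectories

/-- A nonnegative continuous function with a bounded primitive is integrable on the line. -/
lemma lintegral_le_of_hasDerivAt {Φ h : ℝ → ℝ} {B : ℝ} (hΦ : ∀ t, HasDerivAt Φ (h t) t)
    (hh : Continuous h) (hh0 : ∀ t, 0 ≤ h t) (hB : ∀ t, |Φ t| ≤ B) :
    ∫⁻ t, ENNReal.ofReal (h t) ≤ ENNReal.ofReal (B + B) := by
  have hcover : AECover (volume : Measure ℝ) atTop fun N : ℕ => Ioc (-(N : ℝ)) N :=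
    aecover_Ioc (tendsto_neg_atTop_atBot.comp tendsto_natCast_atTop_atTop)
      tendsto_natCast_atTop_atTop
  refine le_of_tendsto' (hcover.lintegral_tendsto_of_countably_generated
    (hh.measurable.ennreal_ofReal.aemeasurable)) fun N => ?_
  have hN : -(N : ℝ) ≤ N := by linarith [(Nat.cast_nonneg N : (0 : ℝ) ≤ N)]
  have hi : IntervalIntegrable h volume (-(N : ℝ)) N := hh.intervalIntegrable _ _
  rw [← ofReal_integral_eq_lintegral_ofReal ((intervalIntegrable_iff_integrableOn_Ioc_of_le hN).1 hi)
    (Eventually.of_forall hh0), ← intervalIntegral.integral_of_le hN,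
    intervalIntegral.integral_eq_sub_of_hasDerivAt (fun t _ => hΦ t) hi]
  exact ENNReal.ofReal_le_ofReal
    ((le_abs_self _).trans ((abs_sub _ _).trans (add_le_add (hB _) (hB _))))

variable {α : ℝ → ℝ} {v : Eucl 2 → ℝ} {Z : ℝ → Eucl 2 → Eucl 2} {τ : Eucl 2 → ℝ}
  {X : ℝ → Eucl 3 → Eucl 3} {K : ℝ≥0}

/-- A curve which moves along `∇v` with the variable speed `c` is a reparametrized trajectory of
`∇v`. -/
lemma eq_gradientFlow_of_hasDerivAt_smul (hF : LipschitzWith K (∇ v)) (hZ : IsFlow (∇ v) Z)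
    {P : ℝ → Eucl 2} {c : ℝ → ℝ} {B : ℝ} (hc : Continuous c) (hcB : ∀ t, |c t| ≤ B)
    (hP : ∀ t, HasDerivAt P (c t • ∇ v (P t)) t) (t : ℝ) :
    P t = Z (∫ s in (0 : ℝ)..t, c s) (P 0) := by
  have hB0 : 0 ≤ B := (abs_nonneg _).trans (hcB 0)
  refine congrFun (ODE_solution_unique_univ (v := fun t q => c t • ∇ v q) (s := fun _ => univ)
    (K := NNReal.mk B hB0 * K) (t₀ := 0)
    (f := P) (g := fun t => Z (∫ s in (0 : ℝ)..t, c s) (P 0))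
    (fun t => LipschitzOnWith.of_dist_le_mul fun x _ y _ => ?_) (fun t => ⟨hP t, mem_univ _⟩)
    (fun t => ⟨?_, mem_univ _⟩) (by simp [(hZ _).1])) t
  · rw [dist_smul₀, NNReal.coe_mul, mul_assoc]
    exact mul_le_mul (hcB t) (hF.dist_le_mul x y) dist_nonneg hB0
  · exact HasDerivAt.scomp t ((hZ (P 0)).2 _)
      (intervalIntegral.integral_hasDerivAt_right (hc.intervalIntegrable _ _)
        hc.stronglyMeasurable.stronglyMeasurableAtFilter hc.continuousAt)

/-- Along the trajectories of `X₃` the function `w_v(x, y) + log α(z)` increases with speed exactly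
`|curl j|² / |j|²`. -/
lemma hasDerivAt_logConductivity_add_log (hα : ContDiff ℝ 2 α) (hα_pos : ∀ z, 0 < α z)
    (hv : ContDiff ℝ 3 v) (hv_ne : ∀ p, ∇ v p ≠ 0) (hF : LipschitzWith K (∇ v))
    {B : ℝ} (hB : ∀ p, |(Δ v) p / ‖∇ v p‖ ^ 2| ≤ B) (hZ : IsFlow (∇ v) Z)
    (hτ : ∀ p t, v (Z t p) = 0 ↔ t = τ p)
    (hX : IsFlow (crossCurlField (planarField α v)) X) (x : Eucl 3) (t : ℝ) :
    HasDerivAt (fun t => logConductivity v Z τ (proj (X t x)) + Real.log (α (X t x 2)))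
      (‖curl (planarField α v) (X t x)‖ ^ 2 / ‖planarField α v (X t x)‖ ^ 2) t := by
  have hX' : ∀ t, HasDerivAt (fun s => X s x)
      (lift (((Δ v) (proj (X t x)) / ‖∇ v (proj (X t x))‖ ^ 2) • ∇ v (proj (X t x)))
        (deriv α (X t x 2) / α (X t x 2))) t := fun t => by
    rw [← crossCurlField_planarField hα hα_pos hv hv_ne]
    exact (hX x).2 t
  have hΔc := (contDiff_laplacian hv).continuous
  have hgc : Continuous (∇ v) := hF.continuous
  set P : ℝ → Eucl 2 := fun t => proj (X t x) with hP
  set c : ℝ → ℝ := fun t => (Δ v) (P t) / ‖∇ v (P t)‖ ^ 2 with hc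
  have hPd : ∀ t, HasDerivAt P (c t • ∇ v (P t)) t := fun t => by
    have := proj.hasFDerivAt.comp_hasDerivAt t (hX' t)
    rwa [proj_lift] at this
  have hPc : Continuous P := continuous_iff_continuousAt.2 fun t => (hPd t).continuousAt
  have hcc : Continuous c := (hΔc.comp hPc).div ((hgc.comp hPc).norm.pow 2) fun t =>
    pow_ne_zero 2 (norm_ne_zero_iff.2 (hv_ne _))
  have hPZ := eq_gradientFlow_of_hasDerivAt_smul hF hZ hcc (fun t => hB (P t)) hPd
  have h1 : HasDerivAt (fun t => logConductivity v Z τ (P t)) ((Δ v) (P t) * c t) t := by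
    have h := (hasDerivAt_logConductivity_flow hF hZ hΔc hτ (P 0)
      (∫ s in (0 : ℝ)..t, c s)).comp t
      (intervalIntegral.integral_hasDerivAt_right (hcc.intervalIntegrable 0 t)
        hcc.stronglyMeasurable.stronglyMeasurableAtFilter hcc.continuousAt)
    rw [← hPZ t] at h
    refine h.congr_of_eventuallyEq (Eventually.of_forall fun s => ?_)
    simp only [Function.comp_apply, ← hPZ s]
  have h2 : HasDerivAt (fun t => Real.log (α (X t x 2))) ((deriv α (X t x 2) / α (X t x 2)) ^ 2)
      t := by
    have h3 := (EuclideanSpace.proj (2 : Fin 3) : Eucl 3 →L[ℝ] ℝ).hasFDerivAt.comp_hasDerivAt t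
      (hX' t)
    have h4 := (((hα.differentiable two_ne_zero) (X t x 2)).hasDerivAt.comp t h3).log
      (hα_pos _).ne'
    refine h4.congr_deriv ?_
    simp [sq, mul_div_assoc]
    ring
  rw [curl_sq_div_planarField_sq hα hα_pos hv hv_ne]
  refine (h1.add h2).congr_deriv ?_
  simp only [hc, hP]
  ring

end Trajectories

/-! ### Regularity and periodicity of the field `j × curl j / |j|²` -/

section CrossCurl

variable {α : ℝ → ℝ} {v : Eucl 2 → ℝ}

lemma contDiff_crossCurlField (hα : ContDiff ℝ 2 α) (hα_pos : ∀ z, 0 < α z)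
    (hv : ContDiff ℝ 3 v) (hv_ne : ∀ p, ∇ v p ≠ 0) :
    ContDiff ℝ 1 (crossCurlField (planarField α v)) := by
  rw [funext (crossCurlField_planarField hα hα_pos hv hv_ne)]
  have hg : ContDiff ℝ 1 (∇ v) := contDiff_gradient (k := 3) (m := 1) hv (by norm_num)
  have hs : ContDiff ℝ 1 fun p => ((Δ v) p / ‖∇ v p‖ ^ 2) • ∇ v p :=
    ((contDiff_laplacian hv).div (hg.norm_sq ℝ) fun p =>
      pow_ne_zero 2 (norm_ne_zero_iff.2 (hv_ne p))).smul hg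
  have hs3 := hs.comp proj.contDiff
  have hα' : ContDiff ℝ 1 fun z => deriv α z / α z :=
    (ContDiff.deriv' (hα : ContDiff ℝ (1 + 1) α)).div (hα.of_le (by norm_num)) fun z =>
      (hα_pos z).ne'
  refine contDiff_euclidean.2 fun i => ?_
  fin_cases i
  · exact contDiff_euclidean.1 hs3 0
  · exact contDiff_euclidean.1 hs3 1
  · exact hα'.comp (EuclideanSpace.proj (2 : Fin 3) : Eucl 3 →L[ℝ] ℝ).contDiff

lemma cubePeriodic_planarField (hα_per : Function.Periodic α 1) (hv_per : CubePeriodic (∇ v)) :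
    CubePeriodic (planarField α v) := fun k x => by
  have : α ((x + latticeVec k) 2) = α (x 2) := by
    simpa [latticeVec] using hα_per.int_mul (k 2) (x 2)
  rw [planarField_eq, planarField_eq, this, map_add, proj_latticeVec, hv_per]

lemma CubePeriodic.crossCurlField {j : Eucl 3 → Eucl 3} (hj : CubePeriodic j) :
    CubePeriodic (crossCurlField j) := fun k x => by
  have h : ∀ i l, partialDeriv i (fun y => j y l) (x + latticeVec k) =
      partialDeriv i (fun y => j y l) x := fun i l => by
    simp only [partialDeriv, (hj.comp fun y => y l).fderiv k x]
  simp only [IsotropicRealizability.crossCurlField, curl, h, hj k x]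

end CrossCurl

end IsotropicRealizability

/-! ### Existence of the flows and the three assertions -/

theorem mainTheorem5 (α : ℝ → ℝ) (v : Eucl 2 → ℝ)
    (hα : ContDiff ℝ 2 α) (hα_per : Function.Periodic α 1) (hα_pos : ∀ z, 0 < α z)
    (hv : ContDiff ℝ 3 v) (hv_per : CubePeriodic (∇ v)) (hv_ne : ∀ p, ∇ v p ≠ 0) :
    ∃ (Z : ℝ → Eucl 2 → Eucl 2) (τ : Eucl 2 → ℝ) (X₃ : ℝ → Eucl 3 → Eucl 3),
      -- `Z` is the flow of `∇v`, and it is unique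
      (∀ Z' : ℝ → Eucl 2 → Eucl 2, IsFlow (∇ v) Z' ↔ Z' = Z) ∧
      -- `τ p` is the unique time at which the trajectory issued from `p` meets `{v = 0}`
      (∀ (p : Eucl 2) (t : ℝ), v (Z t p) = 0 ↔ t = τ p) ∧
      -- `X₃` is the flow of `(j × curl j) / |j|²`, and it is unique
      (∀ X' : ℝ → Eucl 3 → Eucl 3,
        IsFlow (crossCurlField (planarField α v)) X' ↔ X' = X₃) ∧
      -- if `w_v` is bounded, then `j` is isotropically realizable in the torus
      (MemLp (logConductivity v Z τ) ∞ → RealizableInTorus (planarField α v)) ∧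
      -- converse, for realizability with a positive periodic conductivity of class `C¹`
      ((∃ σ : Eucl 3 → ℝ, ContDiff ℝ 1 σ ∧ CubePeriodic σ ∧ (∀ x, 0 < σ x) ∧
          RealizableInTorusWith (planarField α v) σ) →
        MemLp (logConductivity v Z τ) ∞) ∧
      -- if `w_v` is bounded, then so is the integral along the trajectories of `X₃`
      (MemLp (logConductivity v Z τ) ∞ →
        ∃ C : ℝ≥0, ∀ x : Eucl 3,
          ∫⁻ s : ℝ, ENNReal.ofReal
            (‖curl (planarField α v) (X₃ s x)‖ ^ 2 / ‖planarField α v (X₃ s x)‖ ^ 2) ≤ C) := by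
  have hg : ContDiff ℝ 1 (∇ v) := contDiff_gradient (k := 3) (m := 1) hv (by norm_num)
  have hvd : Differentiable ℝ v := hv.differentiable (by norm_num)
  have hΔ : ContDiff ℝ 1 (Δ v) := contDiff_laplacian hv
  have hΔ_per : CubePeriodic (Δ v) := cubePeriodic_laplacian (hv.of_le (by norm_num)) hv_per
  obtain ⟨K, hF⟩ := hv_per.exists_lipschitzWith hg
  obtain ⟨M, hM0, hM⟩ := hv_per.exists_norm_le hg.continuous
  have hsq_pos : ∀ p, 0 < ‖∇ v p‖ ^ 2 := fun p => pow_pos (norm_pos_iff.2 (hv_ne p)) 2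
  obtain ⟨m, hm0, hm⟩ := (hv_per.comp fun a => ‖a‖ ^ 2).exists_pos_le
    (hg.continuous.norm.pow 2) hsq_pos
  obtain ⟨B, -, hB⟩ := hΔ_per.exists_norm_le hΔ.continuous
  obtain ⟨K', hΔL⟩ := hΔ_per.exists_lipschitzWith hΔ
  obtain ⟨c, -, hc⟩ := (hΔ_per.comp₂ hv_per fun a b => a / ‖b‖ ^ 2).exists_norm_le
    (hΔ.continuous.div (hg.continuous.norm.pow 2) fun p => (hsq_pos p).ne')
  have hα3_per : CubePeriodic fun x : Eucl 3 => α (x 2) := fun k x => by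
    simpa [latticeVec] using hα_per.int_mul (k 2) (x 2)
  have hα3 : Continuous fun x : Eucl 3 => α (x 2) := hα.continuous.comp (by fun_prop)
  obtain ⟨a, ha0, ha⟩ := hα3_per.exists_pos_le hα3 fun x => hα_pos (x 2)
  obtain ⟨A, -, hA⟩ := hα3_per.exists_norm_le hα3
  obtain ⟨D, -, hD⟩ := (hα3_per.comp Real.log).exists_norm_le
    (hα3.log fun x => (hα_pos (x 2)).ne')
  obtain ⟨Z, hZ⟩ := exists_unique_isFlow hF hM
  have hZf : IsFlow (∇ v) Z := (hZ Z).2 rfl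
  obtain ⟨τ, hτ⟩ := hZf.exists_hittingTime hvd hm0 hm
  have hX_per := (cubePeriodic_planarField hα_per hv_per).crossCurlField
  have hXc := contDiff_crossCurlField hα hα_pos hv hv_ne
  obtain ⟨KX, hKX⟩ := hX_per.exists_lipschitzWith hXc
  obtain ⟨MX, -, hMX⟩ := hX_per.exists_norm_le hXc.continuous
  obtain ⟨X, hX⟩ := exists_unique_isFlow hKX hMX
  have hwL : LocallyLipschitz (logConductivity v Z τ) :=
    locallyLipschitz_logConductivity hvd hF hZf hτ hm0 hm hM hB hΔL
  have hwb : MemLp (logConductivity v Z τ) ∞ → ∃ C, ∀ p, |logConductivity v Z τ p| ≤ C :=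
    fun h => by
      have htop : eLpNormEssSup (logConductivity v Z τ) volume ≠ ⊤ := by
        rw [← eLpNorm_exponent_top]
        exact h.eLpNorm_ne_top
      have hae : ∀ᵐ p, ‖logConductivity v Z τ p‖ ≤
          (eLpNormEssSup (logConductivity v Z τ) volume).toReal := by
        filter_upwards [ae_le_eLpNormEssSup (f := logConductivity v Z τ)] with p hp
        rw [← toReal_enorm]
        exact ENNReal.toReal_mono htop hp
      exact ⟨_, forall_of_ae_of_isClosed (isClosed_le hwL.continuous.norm continuous_const) hae⟩
  refine ⟨Z, τ, X, hZ, hτ, hX, fun h => ?_, ?_, fun h => ?_⟩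
  · obtain ⟨C, hC⟩ := hwb h
    obtain ⟨Y, hY⟩ := exists_unique_isFlow (F := fun p => perp (∇ v p))
      (perp.lipschitz.comp hF) (M := M) (fun p => (norm_perp _).le.trans (hM p))
    have hYf := (hY Y).2 rfl
    have hwZ : ∀ p, HasDerivAt (fun t => logConductivity v Z τ (Z t p)) ((Δ v) p) 0 := fun p => by
      simpa only [(hZf p).1] using hasDerivAt_logConductivity_flow hF hZf hΔ.continuous hτ p 0
    obtain ⟨u, L, b, hb, huL, hinc, huZ, huY⟩ :=
      exists_periodic_potential hv hv_per hF hm0 hm hM hZf hYf hwL hwZ hC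
    exact realizableInTorus_of_potential hα.continuous ha0 (fun z => ha (lift 0 z))
      (fun z => (le_abs_self _).trans (hA (lift 0 z))) hα_per hg.continuous hv_per hm0 hm hM hZf
      hYf huL hinc hb huZ huY
  · rintro ⟨σ, hσ, hσ_per, hσ_pos, hreal⟩
    obtain ⟨C, hC⟩ := exists_logConductivity_le (τ := τ) hα hα_per hα_pos hv hZf hσ hσ_per hσ_pos
      hreal
    exact memLp_top_of_bound hwL.continuous.aestronglyMeasurable C (Filter.Eventually.of_forall hC)
  · obtain ⟨C, hC⟩ := hwb h
    have hXf := (hX X).2 rfl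
    refine ⟨(C + D + (C + D)).toNNReal, fun x => ?_⟩
    refine lintegral_le_of_hasDerivAt
      (hasDerivAt_logConductivity_add_log hα hα_pos hv hv_ne hF hc hZf hτ hXf x) ?_
      (fun t => by positivity)
      fun t => (abs_add_le _ _).trans (add_le_add (hC _) (hD _))
    simp only [curl_sq_div_planarField_sq hα hα_pos hv hv_ne]
    have hXt := hXf.continuous_time x
    have hX2 : Continuous fun t => X t x 2 :=
      (EuclideanSpace.proj (2 : Fin 3) : Eucl 3 →L[ℝ] ℝ).continuous.comp hXt
    have hXp : Continuous fun t => proj (X t x) := proj.continuous.comp hXt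
    exact ((((hα.continuous_deriv (by norm_num)).comp hX2).div (hα.continuous.comp hX2)
      fun t => (hα_pos _).ne').pow 2).add (((hΔ.continuous.comp hXp).pow 2).div
      ((hg.continuous.comp hXp).norm.pow 2) fun t => (hsq_pos _).ne')
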